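/- Let $\boldsymbol{k}$ be a field of characteristic zero, let $m\ge 2$ be an even integer and let $S$ be a commutative $\boldsymbol{k}$-algebra with a Nambu-Poisson bracket of arity $m$, i.e. a $\boldsymbol{k}$-multilinear antisymmetric map $\{\ ,\dots,\ \}:S^m\to S$ such that $$\{a_1,\dots,a_{m-1},bc\}=b\{a_1,\dots,a_{m-1},c\}+c\{a_1,\dots,a_{m-1},b\},$$ $$\{a_1,\dots,a_{m-1},\{b_1,\dots,b_m\}\}=\sum_{l=1}^m\{b_1,\dots,b_{l-1},\{a_1,\dots,a_{m-1},b_l\},b_{l+1},\dots,b_m\}.$$ Let $I\subseteq S$ be a Nambu-Poisson ideal, i.e. an ideal with $\{I,S,\dots,S\}\subseteq I$, and let $A=S/I$ be the quotient Nambu-Poisson algebra, with bracket $\{g_1+I,\dots,g_m+I\}=\{g_1,\dots,g_m\}+I$ and Hamiltonian vector fields $X_{a_1\dots a_{m-1}}=\{a_1,\dots,a_{m-1},\ \cdot\ \}\in\operatorname{Der}(A)$. Then $$[\mathrm{d}a_1,\dots,\mathrm{d}a_m]=\mathrm{d}\{a_1,\dots,a_m\},\qquad \rho(\mathrm{d}a_1,\dots,\mathrm{d}a_{m-1},\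 \cdot\ )=X_{a_1\dots a_{m-1}}\qquad(a_1,\dots,a_m\in A)$$ define a Lie-Rinehart $m$-algebra structure on the $A$-module $\Omega_{A|\boldsymbol{k}}$ of Kähler differentials, i.e. there is exactly one such structure satisfying these equations. Here a Lie-Rinehart $m$-algebra structure on an $A$-module $V$ consists of a $\boldsymbol{k}$-multilinear alternating bracket $[\ ,\dots,\ ]:V^m\to V$ and an anchor $\rho:V^{m-1}\times A\to A$, which is $A$-multilinear and alternating in the first $m-1$ arguments and $\boldsymbol{k}$-linear in the last one, such that for all $v_i\in V$ and $a,b\in A$ $$\sum_{\sigma\in \mathrm{Sh}^{-1}_{m,m-1}}(-1)^\sigma[[v_{\sigma(1)},\dots,v_{\sigma(m)}],v_{\sigma(m+1)},\dots,v_{\sigma(2m-1)}]=0,$$ $$[v_1,\dots,v_{m-1},av_m]=a[v_1,\dots,v_m]+\rho(v_1,\dots,v_{m-1},a)v_m,$$ $$\sum_{\sigma\in \mathrm{Sh}^{-1}_{m,m-2}}(-1)^\sigma\rho([v_{\sigma(1)},\dots,v_{\sigma(m)}],v_{\sigma(m+1)},\dots,v_{\sigma(2m-2)},a)+\sum_{\sigma\in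 \mathrm{Sh}^{-1}_{m-1,m-1}}(-1)^\sigma\rho(v_{\sigma(m)},\dots,v_{\sigma(2m-2)},\rho(v_{\sigma(1)},\dots,v_{\sigma(m-1)},a))=0,$$ $$\rho(v_1,\dots,v_{m-1},ab)=a\rho(v_1,\dots,v_{m-1},b)+b\rho(v_1,\dots,v_{m-1},a),$$ where $\mathrm{Sh}^{-1}_{q,r}$ is the set of permutations $\sigma$ of $\{1,\dots,q+r\}$ with $\sigma(1)<\dots<\sigma(q)$ and $\sigma(q+1)<\dots<\sigma(q+r)$, and $(-1)^\sigma$ is the sign of $\sigma$. -/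

import Mathlib

open scoped KaehlerDifferential

/-- A Nambu-Poisson structure of arity `m = p + 2` on the commutative `k`-algebra `S`: a
`k`-multilinear alternating bracket `{a₁, …, aₘ}` satisfying the Leibniz rule (in the last, hence in
every, argument) and the fundamental (Filippov) identity. -/
structure NambuPoisson (k S : Type*) [Field k] [CommRing S] [Algebra k S] (p : ℕ) where
  /-- The bracket `{a₁, …, aₘ}`. -/
  bracket : S [⋀^Fin (p + 2)]→ₗ[k] S
  /-- `{a₁, …, aₘ₋₁, b c} = b {a₁, …, aₘ₋₁, c} + c {a₁, …, aₘ₋₁, b}` -/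
  leibniz : ∀ (a : Fin (p + 1) → S) (b c : S),
    bracket (Fin.snoc a (b * c)) = b * bracket (Fin.snoc a c) + c * bracket (Fin.snoc a b)
  /-- `{a₁, …, aₘ₋₁, {b₁, …, bₘ}} = ∑ₗ {b₁, …, {a₁, …, aₘ₋₁, bₗ}, …, bₘ}` -/
  fundamental : ∀ (a : Fin (p + 1) → S) (b : Fin (p + 2) → S),
    bracket (Fin.snoc a (bracket b)) =
      ∑ l : Fin (p + 2), bracket (Function.update b l (bracket (Fin.snoc a (b l))))

namespace NambuPoisson

variable {k S : Type*} [Field k] [CommRing S] [Algebra k S] {p : ℕ}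

/-- The Hamiltonian vector field `X_{a₁, …, aₘ₋₁} = {a₁, …, aₘ₋₁, ·}`, a `k`-derivation. -/
def hamiltonian (P : NambuPoisson k S p) (a : Fin (p + 1) → S) : Derivation k S S :=
  Derivation.mk'
    { toFun := fun b => P.bracket (Fin.snoc a b)
      map_add' := fun b c => by
        have h := P.bracket.map_update_add (Fin.snoc a (0 : S)) (Fin.last (p + 1)) b c
        simpa only [Fin.update_snoc_last] using h
      map_smul' := fun t b => by
        have h := P.bracket.map_update_smul (Fin.snoc a (0 : S)) (Fin.last (p + 1)) t b
        simpa only [Fin.update_snoc_last, RingHom.id_apply] using h }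
    (fun b c => P.leibniz a b c)

/-- `I` is a Nambu-Poisson ideal: `{I, S, …, S} ⊆ I`. -/
def IsNambuIdeal (P : NambuPoisson k S p) (I : Ideal S) : Prop :=
  ∀ f ∈ I, ∀ a : Fin (p + 1) → S, P.bracket (Fin.cons f a) ∈ I

theorem IsNambuIdeal.update_mem {P : NambuPoisson k S p} {I : Ideal S} (hI : P.IsNambuIdeal I)
    (u : Fin (p + 2) → S) (i : Fin (p + 2)) {f : S} (hf : f ∈ I) :
    P.bracket (Function.update u i f) ∈ I := by
  set w := Function.update u i f with hw
  have h0 : w i = f := by simp [hw]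
  have hmem : P.bracket (w ∘ Equiv.swap 0 i) ∈ I := by
    have := hI f hf (Fin.tail (w ∘ Equiv.swap 0 i))
    have e : (Fin.cons f (Fin.tail (w ∘ Equiv.swap 0 i)) : Fin (p + 2) → S)
        = w ∘ Equiv.swap 0 i := by
      have h1 : f = (w ∘ Equiv.swap 0 i) 0 := by simp [h0]
      conv_lhs => rw [h1]
      exact Fin.cons_self_tail _
    rwa [e] at this
  rw [P.bracket.map_perm] at hmem
  rcases Int.units_eq_one_or (Equiv.Perm.sign (Equiv.swap 0 i)) with h | h
  · rw [h, one_smul] at hmem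
    exact hmem
  · rw [h, Units.neg_smul, one_smul] at hmem
    exact neg_mem_iff.mp hmem

/-- The bracket modulo a Nambu-Poisson ideal depends only on the classes of its arguments. -/
theorem IsNambuIdeal.mk_congr {P : NambuPoisson k S p} {I : Ideal S} (hI : P.IsNambuIdeal I)
    (u w : Fin (p + 2) → S) (h : ∀ i, Ideal.Quotient.mk I (u i) = Ideal.Quotient.mk I (w i)) :
    Ideal.Quotient.mk I (P.bracket u) = Ideal.Quotient.mk I (P.bracket w) := by
  classical
  have key : ∀ s : Finset (Fin (p + 2)),
      Ideal.Quotient.mk I (P.bracket (s.piecewise w u)) = Ideal.Quotient.mk I (P.bracket u) := by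
    intro s
    induction s using Finset.induction_on with
    | empty => simp
    | insert i s his ih =>
      rw [← ih, Finset.piecewise_insert, Ideal.Quotient.eq]
      have e : (s.piecewise w u) = Function.update (s.piecewise w u) i (u i) := by
        rw [Function.eq_update_iff]
        simp [his]
      have e2 : P.bracket (s.piecewise w u)
          = P.bracket (Function.update (s.piecewise w u) i (u i)) := congrArg _ e
      rw [e2, ← P.bracket.map_update_sub]
      exact hI.update_mem _ _ (Ideal.Quotient.eq.mp (h i).symm)
  have := key Finset.univ
  rw [Finset.piecewise_univ] at this
  exact this.symm

/-- The underlying function of the bracket on `S ⧸ I`, computed on representatives. -/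
noncomputable def quotientFun (P : NambuPoisson k S p) (I : Ideal S) (v : Fin (p + 2) → S ⧸ I) :
    S ⧸ I :=
  Ideal.Quotient.mk I (P.bracket fun i => (v i).out)

theorem IsNambuIdeal.quotientFun_mk {P : NambuPoisson k S p} {I : Ideal S}
    (hI : P.IsNambuIdeal I) (u : Fin (p + 2) → S) :
    P.quotientFun I (fun i => Ideal.Quotient.mk I (u i)) = Ideal.Quotient.mk I (P.bracket u) :=
  hI.mk_congr _ _ fun _ => Ideal.Quotient.mk_out _

theorem mk_update {I : Ideal S} (u : Fin (p + 2) → S) (i : Fin (p + 2)) (x : S) :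
    Function.update (fun j => Ideal.Quotient.mk I (u j)) i (Ideal.Quotient.mk I x) =
      fun j => Ideal.Quotient.mk I (Function.update u i x j) := by
  funext j
  exact (Function.apply_update (fun _ => Ideal.Quotient.mk I) u i x j).symm

theorem mk_snoc {I : Ideal S} (a : Fin (p + 1) → S) (x : S) :
    (Fin.snoc (fun j => Ideal.Quotient.mk I (a j)) (Ideal.Quotient.mk I x) :
        Fin (p + 2) → S ⧸ I) =
      fun j => Ideal.Quotient.mk I ((Fin.snoc a x : Fin (p + 2) → S) j) := by
  funext j
  refine Fin.lastCases ?_ (fun i => ?_) j <;> simp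

theorem exists_lift {I : Ideal S} {n : ℕ} (v : Fin n → S ⧸ I) :
    ∃ u : Fin n → S, v = fun j => Ideal.Quotient.mk I (u j) :=
  ⟨fun j => (v j).out, funext fun _ => (Ideal.Quotient.mk_out _).symm⟩

/-- The bracket induced on the quotient by a Nambu-Poisson ideal. -/
noncomputable def quotientBracket (P : NambuPoisson k S p) (I : Ideal S) (hI : P.IsNambuIdeal I) :
    (S ⧸ I) [⋀^Fin (p + 2)]→ₗ[k] (S ⧸ I) where
  toFun := P.quotientFun I
  map_update_add' := by
    intro inst v i x y
    obtain rfl : inst = instDecidableEqFin (p + 2) := Subsingleton.elim _ _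
    obtain ⟨u, rfl⟩ := exists_lift v
    obtain ⟨x, rfl⟩ := Ideal.Quotient.mk_surjective x
    obtain ⟨y, rfl⟩ := Ideal.Quotient.mk_surjective y
    rw [← map_add]
    simp only [mk_update, hI.quotientFun_mk]
    rw [P.bracket.map_update_add, map_add]
  map_update_smul' := by
    intro inst v i t x
    obtain rfl : inst = instDecidableEqFin (p + 2) := Subsingleton.elim _ _
    obtain ⟨u, rfl⟩ := exists_lift v
    obtain ⟨x, rfl⟩ := Ideal.Quotient.mk_surjective x
    have hs : ∀ z : S, t • Ideal.Quotient.mk I z = Ideal.Quotient.mk I (t • z) := fun _ => rfl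
    rw [hs]
    simp only [mk_update, hI.quotientFun_mk]
    rw [P.bracket.map_update_smul, hs]
  map_eq_zero_of_eq' := by
    intro v i j hij hne
    have h : (fun l => (v l).out) i = (fun l => (v l).out) j := by simp only [hij]
    change Ideal.Quotient.mk I (P.bracket fun l => (v l).out) = 0
    rw [P.bracket.map_eq_zero_of_eq _ h hne, map_zero]

theorem quotientBracket_mk (P : NambuPoisson k S p) (I : Ideal S) (hI : P.IsNambuIdeal I)
    (u : Fin (p + 2) → S) :
    P.quotientBracket I hI (fun i => Ideal.Quotient.mk I (u i)) =
      Ideal.Quotient.mk I (P.bracket u) :=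
  hI.quotientFun_mk u

/-- The quotient Nambu-Poisson algebra `S ⧸ I` of `S` by a Nambu-Poisson ideal `I`, with bracket
`{g₁ + I, …, gₘ + I} = {g₁, …, gₘ} + I`. -/
noncomputable def quotient (P : NambuPoisson k S p) (I : Ideal S) (hI : P.IsNambuIdeal I) :
    NambuPoisson k (S ⧸ I) p where
  bracket := P.quotientBracket I hI
  leibniz := by
    intro a b c
    obtain ⟨a, rfl⟩ := exists_lift a
    obtain ⟨b, rfl⟩ := Ideal.Quotient.mk_surjective b
    obtain ⟨c, rfl⟩ := Ideal.Quotient.mk_surjective c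
    rw [← map_mul]
    simp only [mk_snoc, quotientBracket_mk]
    rw [P.leibniz, map_add, map_mul, map_mul]
  fundamental := by
    intro a b
    obtain ⟨a, rfl⟩ := exists_lift a
    obtain ⟨b, rfl⟩ := exists_lift b
    simp only [mk_snoc, mk_update, quotientBracket_mk]
    rw [P.fundamental, map_sum]

/-- The defining property of the quotient bracket. -/
theorem quotient_bracket_mk (P : NambuPoisson k S p) (I : Ideal S) (hI : P.IsNambuIdeal I)
    (g : Fin (p + 2) → S) :
    (P.quotient I hI).bracket (fun i => Ideal.Quotient.mk I (g i)) =
      Ideal.Quotient.mk I (P.bracket g) :=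
  P.quotientBracket_mk I hI g

end NambuPoisson

/-- The set `Sh⁻¹_{q,r}` of `(q, r)`-unshuffles: the permutations `σ` of `q + r` letters with
`σ 1 < ⋯ < σ q` and `σ (q + 1) < ⋯ < σ (q + r)`. -/
def unshuffles (q r : ℕ) : Finset (Equiv.Perm (Fin (q + r))) :=
  {σ | (∀ i j : Fin q, i < j → σ (Fin.castAdd r i) < σ (Fin.castAdd r j)) ∧
    ∀ i j : Fin r, i < j → σ (Fin.natAdd q i) < σ (Fin.natAdd q j)}

/-- A Lie-Rinehart `m`-algebra structure, `m = p + 2`, on the module `V` over the `k`-algebra `A`: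
a `k`-linear bracket `⋀ᵐ V → V` and an anchor `ρ : ⋀_A^{m-1} V ⊗_k A → A`, where
`ρ (v₁, …, vₘ₋₁, a)` is written `anchor v a`. -/
@[ext]
structure LieRinehartMAlgebra (k A V : Type*) [Field k] [CommRing A] [Algebra k A]
    [AddCommGroup V] [Module A V] [Module k V] [IsScalarTower k A V] (p : ℕ) where
  /-- The bracket `[v₁, …, vₘ]`. -/
  bracket : V [⋀^Fin (p + 2)]→ₗ[k] V
  /-- The anchor `ρ (v₁, …, vₘ₋₁, a)`; `A`-linear in the `vᵢ` and `k`-linear in `a`. -/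
  anchor : V [⋀^Fin (p + 1)]→ₗ[A] (A →ₗ[k] A)
  /-- The Jacobi identity, a signed sum over the `(m, m - 1)`-unshuffles. -/
  jacobi : ∀ v : Fin ((p + 2) + (p + 1)) → V,
    ∑ σ ∈ unshuffles (p + 2) (p + 1), (Equiv.Perm.sign σ : ℤ) •
      bracket (Fin.cons (bracket fun i => v (σ (Fin.castAdd (p + 1) i)))
        fun j => v (σ (Fin.natAdd (p + 2) j))) = 0
  /-- `[v₁, …, vₘ₋₁, a vₘ] = a [v₁, …, vₘ] + ρ (v₁, …, vₘ₋₁, a) vₘ` -/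
  bracket_leibniz : ∀ (v : Fin (p + 1) → V) (a : A) (w : V),
    bracket (Fin.snoc v (a • w)) = a • bracket (Fin.snoc v w) + anchor v a • w
  /-- Compatibility of the anchor with the bracket: the terms with the bracket inside are summed over
  the `(m, m - 2)`-unshuffles, the iterated anchors over the `(m - 1, m - 1)`-unshuffles. -/
  anchor_bracket : ∀ (v : Fin ((p + 1) + (p + 1)) → V) (a : A),
    ∑ σ ∈ unshuffles (p + 2) p, (Equiv.Perm.sign σ : ℤ) •
        anchor (Fin.cons
          (bracket fun i => v (Fin.cast (by omega) (σ (Fin.castAdd p i))))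
          fun j => v (Fin.cast (by omega) (σ (Fin.natAdd (p + 2) j)))) a
      + ∑ σ ∈ unshuffles (p + 1) (p + 1), (Equiv.Perm.sign σ : ℤ) •
        anchor (fun j => v (σ (Fin.natAdd (p + 1) j)))
          (anchor (fun i => v (σ (Fin.castAdd (p + 1) i))) a) = 0
  /-- `ρ (v₁, …, vₘ₋₁, a b) = a ρ (v₁, …, vₘ₋₁, b) + b ρ (v₁, …, vₘ₋₁, a)` -/
  anchor_leibniz : ∀ (v : Fin (p + 1) → V) (a b : A),
    anchor v (a * b) = a * anchor v b + b * anchor v a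

/-!
Write `m = p + 2`. Given the Leibniz rules, the defect of the compatibility of the anchor with the
bracket is multilinear over `A`, not only over `k`; once this defect vanishes, the Jacobiator is
multilinear over `A` as well. Both axioms therefore only have to be checked on generators of the
module, and the same principle applied to the difference of two structures gives uniqueness. On
exact differentials both axioms reduce to the vanishing of the Jacobiator `J` of the Nambu bracket,
for which the fundamental identity gives `J = -m J`.

For existence, the Nambu bracket is a derivation in each argument and thus induces an
`A`-multilinear form `π` on differentials, and `X = π (v₁, …, vₘ₋₁, d ·)` is a derivation of `A`.
The bracket of differentials is the higher analogue of the Koszul bracket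
`[v, w] = L_{X v} w - L_{X w} v - d π (v, w)`.
-/

open Equiv

section Antisymmetrization

variable {V M : Type*} [AddCommGroup M] {n : ℕ}

/-- The signed sum of a function of `n` arguments over all permutations of its arguments, without
normalization. -/
def antisymmetrization (F : (Fin n → V) → M) (v : Fin n → V) : M :=
  ∑ σ : Perm (Fin n), (Perm.sign σ : ℤ) • F (v ∘ σ)

theorem antisymmetrization_smul {R : Type*} [Ring R] [Module R M] (a : R)
    (F : (Fin n → V) → M) (v : Fin n → V) :
    antisymmetrization (fun x => a • F x) v = a • antisymmetrization F v := by
  simp only [antisymmetrization, Finset.smul_sum, smul_comm a]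

theorem antisymmetrization_comp_perm (F : (Fin n → V) → M) (v : Fin n → V) (π : Perm (Fin n)) :
    antisymmetrization (fun x => F (x ∘ π)) v = (Perm.sign π : ℤ) • antisymmetrization F v := by
  rw [antisymmetrization, antisymmetrization, Finset.smul_sum]
  refine Fintype.sum_equiv (Equiv.mulRight π) _ _ fun σ => ?_
  rw [smul_smul, coe_mulRight, Perm.sign_mul, Units.val_mul, mul_comm (_ : ℤ), mul_assoc,
    Int.units_coe_mul_self, mul_one, Perm.coe_mul, Function.comp_assoc]

theorem sum_perm_fin_succ (f : Perm (Fin (n + 1)) → M) :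
    ∑ σ, f σ = ∑ j : Fin (n + 1), ∑ τ : Perm (Fin n),
      f (Perm.decomposeFin.symm (0, τ) * j.cycleRange) := by
  let e : Fin (n + 1) × Perm (Fin n) → Perm (Fin (n + 1)) :=
    fun x => Perm.decomposeFin.symm (0, x.2) * x.1.cycleRange
  have he : Function.Bijective e := by
    rw [Fintype.bijective_iff_injective_and_card]
    refine ⟨?_, by simp [Fintype.card_perm, Nat.factorial_succ]⟩
    rintro ⟨j, τ⟩ ⟨j', τ'⟩ h
    have preimage_zero : ∀ x, e x x.1 = 0 := fun x => by simp [e]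
    obtain rfl : j = j' := (e (j, τ)).injective <|
      (preimage_zero (j, τ)).trans (by rw [h]; exact (preimage_zero _).symm)
    simpa using Perm.decomposeFin.symm.injective (mul_right_cancel h)
  rw [← he.sum_comp, Fintype.sum_prod_type]

theorem cons_comp_decomposeFin_symm (w : V) (u : Fin n → V) (τ : Perm (Fin n)) :
    (Fin.cons w u : Fin (n + 1) → V) ∘ Perm.decomposeFin.symm (0, τ) = Fin.cons w (u ∘ τ) := by
  funext i
  cases i using Fin.cases <;> simp

theorem sign_decomposeFin_symm_mul_cycleRange (j : Fin (n + 1)) (τ : Perm (Fin n)) :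
    (Perm.sign (Perm.decomposeFin.symm (0, τ) * j.cycleRange) : ℤ) =
      (-1) ^ (j : ℕ) * Perm.sign τ := by
  simp [Fin.sign_cycleRange, mul_comm]

theorem antisymmetrization_cons (F : (Fin (n + 1) → V) → M) (w : V) (u : Fin n → V) :
    antisymmetrization F (Fin.cons w u) =
      ∑ j : Fin (n + 1), (-1 : ℤ) ^ (j : ℕ) •
        antisymmetrization (fun x => F (j.insertNth w x)) u := by
  simp only [antisymmetrization, Finset.smul_sum]
  rw [sum_perm_fin_succ]
  refine Fintype.sum_congr _ _ fun j => Fintype.sum_congr _ _ fun τ => ?_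
  rw [sign_decomposeFin_symm_mul_cycleRange, mul_smul, Perm.coe_mul, ← Function.comp_assoc,
    cons_comp_decomposeFin_symm, Fin.cons_comp_cycleRange]

theorem antisymmetrization_eq_sum_removeNth (F : (Fin (n + 1) → V) → M) (v : Fin (n + 1) → V) :
    antisymmetrization F v =
      ∑ i : Fin (n + 1), (-1 : ℤ) ^ (i : ℕ) •
        antisymmetrization (fun x => F (Fin.cons (v i) x)) (i.removeNth v) := by
  simp only [antisymmetrization, Finset.smul_sum]
  rw [← Equiv.sum_comp (Equiv.inv (Perm (Fin (n + 1)))), sum_perm_fin_succ]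
  refine Fintype.sum_congr _ _ fun i => ?_
  rw [← Equiv.sum_comp (Equiv.inv (Perm (Fin n)))]
  refine Fintype.sum_congr _ _ fun τ => ?_
  have hv : v ∘ ⇑(Perm.decomposeFin.symm (0, τ⁻¹) * i.cycleRange)⁻¹ =
      Fin.cons (v i) (i.removeNth v ∘ τ) := by
    have h := cons_comp_decomposeFin_symm (v i) (i.removeNth v ∘ τ) τ⁻¹
    rw [mul_inv_rev, Perm.coe_mul, ← Function.comp_assoc, Perm.inv_def i.cycleRange,
      ← Fin.cons_removeNth_eq_comp_cycleRange_symm, Perm.inv_def, Equiv.comp_symm_eq, h,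
      Function.comp_assoc, ← Perm.coe_mul, mul_inv_cancel, Perm.coe_one, Function.comp_id]
  rw [Equiv.inv_apply, Equiv.inv_apply, hv, Perm.sign_inv,
    sign_decomposeFin_symm_mul_cycleRange, Perm.sign_inv, mul_smul]

end Antisymmetrization

section Blocks

variable {V : Type*} {n q r : ℕ}

/-- The first `q` entries of a tuple of length `n = q + r`. -/
def firstBlock (h : q + r = n) (v : Fin n → V) : Fin q → V :=
  fun i => v (Fin.cast h (Fin.castAdd r i))

/-- The last `r` entries of a tuple of length `n = q + r`. -/
def lastBlock (h : q + r = n) (v : Fin n → V) : Fin r → V :=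
  fun j => v (Fin.cast h (Fin.natAdd q j))

theorem firstBlock_update_natAdd (h : q + r = n) (v : Fin n → V) (j : Fin r) (w : V) :
    firstBlock h (Function.update v (Fin.cast h (Fin.natAdd q j)) w) = firstBlock h v := by
  funext i
  exact Function.update_of_ne (Fin.ne_of_val_ne (by grind)) _ _

theorem lastBlock_update_natAdd (h : q + r = n) (v : Fin n → V) (j : Fin r) (w : V) :
    lastBlock h (Function.update v (Fin.cast h (Fin.natAdd q j)) w) =
      Function.update (lastBlock h v) j w :=
  Function.update_comp_eq_of_injective _
    ((Fin.cast_injective h).comp (Fin.natAdd_injective r q)) _ _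

theorem firstBlock_insertNth_castAdd (h : q + 1 + r = n + 1) (h' : q + r = n) (j : Fin (q + 1))
    (w : V) (u : Fin n → V) :
    firstBlock h ((Fin.cast h (Fin.castAdd r j)).insertNth w u) =
      j.insertNth w (firstBlock h' u) := by
  refine Fin.eq_insertNth_iff.mpr ⟨Fin.insertNth_apply_same _ _ _, funext fun i => ?_⟩
  have e : Fin.cast h (Fin.castAdd r (j.succAbove i)) =
      (Fin.cast h (Fin.castAdd r j)).succAbove (Fin.cast h' (Fin.castAdd r i)) := by
    grind [Fin.succAbove]
  rw [Fin.removeNth, firstBlock, e, Fin.insertNth_apply_succAbove, firstBlock]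

theorem lastBlock_insertNth_castAdd (h : q + 1 + r = n + 1) (h' : q + r = n) (j : Fin (q + 1))
    (w : V) (u : Fin n → V) :
    lastBlock h ((Fin.cast h (Fin.castAdd r j)).insertNth w u) = lastBlock h' u := by
  funext i
  have e : Fin.cast h (Fin.natAdd (q + 1) i) =
      (Fin.cast h (Fin.castAdd r j)).succAbove (Fin.cast h' (Fin.natAdd q i)) := by
    grind [Fin.succAbove]
  rw [lastBlock, e, Fin.insertNth_apply_succAbove, lastBlock]

theorem firstBlock_insertNth_natAdd (h : q + (r + 1) = n + 1) (h' : q + r = n) (j : Fin (r + 1))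
    (w : V) (u : Fin n → V) :
    firstBlock h ((Fin.cast h (Fin.natAdd q j)).insertNth w u) = firstBlock h' u := by
  funext i
  have e : Fin.cast h (Fin.castAdd (r + 1) i) =
      (Fin.cast h (Fin.natAdd q j)).succAbove (Fin.cast h' (Fin.castAdd r i)) := by
    grind [Fin.succAbove]
  rw [firstBlock, e, Fin.insertNth_apply_succAbove, firstBlock]

theorem lastBlock_insertNth_natAdd (h : q + (r + 1) = n + 1) (h' : q + r = n) (j : Fin (r + 1))
    (w : V) (u : Fin n → V) :
    lastBlock h ((Fin.cast h (Fin.natAdd q j)).insertNth w u) =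
      j.insertNth w (lastBlock h' u) := by
  refine Fin.eq_insertNth_iff.mpr ⟨Fin.insertNth_apply_same _ _ _, funext fun i => ?_⟩
  have e : Fin.cast h (Fin.natAdd q (j.succAbove i)) =
      (Fin.cast h (Fin.natAdd q j)).succAbove (Fin.cast h' (Fin.natAdd q i)) := by
    grind [Fin.succAbove]
  rw [Fin.removeNth, lastBlock, e, Fin.insertNth_apply_succAbove, lastBlock]

end Blocks

section ShuffleSum

variable {V M : Type*} [AddCommGroup M] {n q r : ℕ}

/-- The signed sum over all permutations of `n = q + r` arguments of a function `G` taking the first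
`q` and the last `r` of them separately. For `G` alternating in each block this is `q! r!` times the
sum over `(q, r)`-unshuffles; unlike the latter it can be reindexed by any permutation. -/
def shuffleSum (h : q + r = n) (G : (Fin q → V) → (Fin r → V) → M) (v : Fin n → V) : M :=
  antisymmetrization (fun x => G (firstBlock h x) (lastBlock h x)) v

theorem shuffleSum_add (h : q + r = n) (G G' : (Fin q → V) → (Fin r → V) → M) (v : Fin n → V) :
    shuffleSum h (fun x y => G x y + G' x y) v = shuffleSum h G v + shuffleSum h G' v := by
  simp only [shuffleSum, antisymmetrization, smul_add, Finset.sum_add_distrib]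

theorem shuffleSum_sub (h : q + r = n) (G G' : (Fin q → V) → (Fin r → V) → M) (v : Fin n → V) :
    shuffleSum h (fun x y => G x y - G' x y) v = shuffleSum h G v - shuffleSum h G' v := by
  simp only [shuffleSum, antisymmetrization, smul_sub, Finset.sum_sub_distrib]

theorem shuffleSum_neg (h : q + r = n) (G : (Fin q → V) → (Fin r → V) → M) (v : Fin n → V) :
    shuffleSum h (fun x y => -G x y) v = -shuffleSum h G v := by
  simp only [shuffleSum, antisymmetrization, smul_neg, Finset.sum_neg_distrib]

theorem shuffleSum_sum {ι : Type*} (s : Finset ι) (h : q + r = n)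
    (G : ι → (Fin q → V) → (Fin r → V) → M) (v : Fin n → V) :
    shuffleSum h (fun x y => ∑ i ∈ s, G i x y) v = ∑ i ∈ s, shuffleSum h (G i) v := by
  simp only [shuffleSum, antisymmetrization, Finset.smul_sum]
  exact Finset.sum_comm

theorem shuffleSum_smul {R : Type*} [Ring R] [Module R M] (a : R) (h : q + r = n)
    (G : (Fin q → V) → (Fin r → V) → M) (v : Fin n → V) :
    shuffleSum h (fun x y => a • G x y) v = a • shuffleSum h G v :=
  antisymmetrization_smul a _ v

theorem shuffleSum_map {N F : Type*} [AddCommGroup N] [FunLike F M N] [AddMonoidHomClass F M N]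
    (φ : F) (h : q + r = n) (G : (Fin q → V) → (Fin r → V) → M) (v : Fin n → V) :
    shuffleSum h (fun x y => φ (G x y)) v = φ (shuffleSum h G v) := by
  simp only [shuffleSum, antisymmetrization, map_sum, map_zsmul]

theorem shuffleSum_comp {W : Type*} (φ : W → V) (h : q + r = n)
    (G : (Fin q → V) → (Fin r → V) → M) (v : Fin n → W) :
    shuffleSum h G (fun i => φ (v i)) =
      shuffleSum h (fun x y => G (fun i => φ (x i)) fun j => φ (y j)) v := rfl

theorem shuffleSum_smul_const {R : Type*} [Ring R] [Module R M] (h : q + r = n)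
    (G : (Fin q → V) → (Fin r → V) → R) (w : M) (v : Fin n → V) :
    shuffleSum h (fun x y => G x y • w) v = shuffleSum h G v • w :=
  shuffleSum_map (LinearMap.toSpanSingleton R M w) h G v

theorem finRotate_pow_val (s : ℕ) (i : Fin (n + 1)) :
    ((finRotate (n + 1) ^ s) i : ℕ) = (i + s) % (n + 1) := by
  induction s with
  | zero => simp [Nat.mod_eq_of_lt i.isLt]
  | succ s ih =>
    rw [pow_succ', Perm.mul_apply, finRotate_apply, Fin.val_add, ih, Fin.val_one',
      Nat.mod_add_mod, Nat.add_mod_mod, Nat.add_assoc]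

theorem sign_finRotate_pow (h : q + r = n + 1) :
    (Perm.sign (finRotate (n + 1) ^ r) : ℤ) = (-1) ^ (q * r) := by
  have hr : Even (r * (r - 1)) := Nat.even_mul_pred_self r
  have hn : n * r + r = q * r + (r * (r - 1) + r) := by
    cases r with
    | zero => simp
    | succ r => grind
  have hqr : n * r = q * r + r * (r - 1) := by omega
  rw [map_pow, sign_finRotate, Nat.add_sub_cancel, ← pow_mul, hqr, Units.val_pow_eq_pow_val,
    Units.val_neg, Units.val_one, pow_add, hr.neg_one_pow, mul_one]

theorem shuffleSum_swap_blocks (h : q + r = n) (h' : r + q = n)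
    (G : (Fin q → V) → (Fin r → V) → M) (v : Fin n → V) :
    shuffleSum h' (fun y x => G x y) v = (-1 : ℤ) ^ (q * r) • shuffleSum h G v := by
  cases n with
  | zero =>
    obtain rfl : q = 0 := by omega
    obtain rfl : r = 0 := by omega
    simp only [shuffleSum, antisymmetrization, zero_mul, pow_zero, one_smul,
      Subsingleton.elim _ (default : Fin 0 → V)]
  | succ n =>
    have first (x : Fin (n + 1) → V) :
        firstBlock h (x ∘ (finRotate (n + 1) ^ r : Perm _)) = lastBlock h' x := by
      funext i
      refine congrArg x (Fin.ext ?_)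
      simp only [finRotate_pow_val, Fin.val_cast, Fin.val_castAdd, Fin.val_natAdd]
      rw [Nat.mod_eq_of_lt] <;> omega
    have last (x : Fin (n + 1) → V) :
        lastBlock h (x ∘ (finRotate (n + 1) ^ r : Perm _)) = firstBlock h' x := by
      funext i
      refine congrArg x (Fin.ext ?_)
      simp only [finRotate_pow_val, Fin.val_cast, Fin.val_castAdd, Fin.val_natAdd]
      rw [show q + (i : ℕ) + r = i + (n + 1) by omega, Nat.add_mod_right, Nat.mod_eq_of_lt]
      omega
    rw [← sign_finRotate_pow h, shuffleSum, shuffleSum, ← antisymmetrization_comp_perm]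
    simp only [first, last]

theorem shuffleSum_cons_eq_sum (h : q + 1 + r = n + 1) (h' : q + r = n)
    (G : (Fin (q + 1) → V) → (Fin r → V) → M) (w : V) (u : Fin n → V) :
    shuffleSum h G (Fin.cons w u) =
      ∑ j : Fin (q + 1), (-1 : ℤ) ^ (j : ℕ) • shuffleSum h' (fun x y => G (j.insertNth w x) y) u +
      ∑ j : Fin r, (-1 : ℤ) ^ (q + 1 + j) • antisymmetrization (fun x =>
        G (firstBlock h ((Fin.cast h (Fin.natAdd (q + 1) j)).insertNth w x))
          (lastBlock h ((Fin.cast h (Fin.natAdd (q + 1) j)).insertNth w x))) u := by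
  rw [shuffleSum, antisymmetrization_cons, ← (finCongr h).sum_comp, Fin.sum_univ_add]
  simp only [finCongr_apply, firstBlock_insertNth_castAdd h h', lastBlock_insertNth_castAdd h h']
  rfl

theorem shuffleSum_eq_sum_removeNth (h : q + 1 + r = n + 1) (h' : q + r = n)
    (G : V → (Fin q → V) → (Fin r → V) → M) (v : Fin (n + 1) → V) :
    shuffleSum h (fun x y => G (x 0) (Fin.tail x) y) v =
      ∑ i : Fin (n + 1), (-1 : ℤ) ^ (i : ℕ) • shuffleSum h' (G (v i)) (i.removeNth v) := by
  rw [shuffleSum, antisymmetrization_eq_sum_removeNth]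
  have first (w : V) (x : Fin n → V) :
      firstBlock h (Fin.cons w x) = Fin.cons w (firstBlock h' x) := by
    rw [← Fin.insertNth_zero', ← Fin.insertNth_zero']
    exact firstBlock_insertNth_castAdd h h' 0 w x
  have last (w : V) (x : Fin n → V) : lastBlock h (Fin.cons w x) = lastBlock h' x := by
    rw [← Fin.insertNth_zero']
    exact lastBlock_insertNth_castAdd h h' 0 w x
  simp only [first, last, Fin.cons_zero, Fin.tail_cons]
  rfl

end ShuffleSum

section Unshuffles

variable {n q r : ℕ}

/-- The block-diagonal embedding: the permutations of `q + r` letters that permute the first `q`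
and the last `r` letters separately. -/
def blockPerm (q r : ℕ) : Perm (Fin q) × Perm (Fin r) →* Perm (Fin (q + r)) :=
  finSumFinEquiv.permCongrHom.toMonoidHom.comp (Perm.sumCongrHom (Fin q) (Fin r))

@[simp]
theorem blockPerm_castAdd (γ : Perm (Fin q) × Perm (Fin r)) (i : Fin q) :
    blockPerm q r γ (Fin.castAdd r i) = Fin.castAdd r (γ.1 i) := by
  simp [blockPerm, Equiv.permCongr_apply]

@[simp]
theorem blockPerm_natAdd (γ : Perm (Fin q) × Perm (Fin r)) (j : Fin r) :
    blockPerm q r γ (Fin.natAdd q j) = Fin.natAdd q (γ.2 j) := by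
  simp [blockPerm, Equiv.permCongr_apply]

theorem sign_blockPerm (γ : Perm (Fin q) × Perm (Fin r)) :
    Perm.sign (blockPerm q r γ) = Perm.sign γ.1 * Perm.sign γ.2 := by
  simp [blockPerm, Perm.sign_permCongr, Perm.sign_sumCongr]

theorem mul_blockPerm_comp_castAdd (σ : Perm (Fin (q + r))) (γ : Perm (Fin q) × Perm (Fin r)) :
    ⇑(σ * blockPerm q r γ) ∘ Fin.castAdd r = (σ ∘ Fin.castAdd r) ∘ γ.1 := by
  funext i
  simp

theorem mul_blockPerm_comp_natAdd (σ : Perm (Fin (q + r))) (γ : Perm (Fin q) × Perm (Fin r)) :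
    ⇑(σ * blockPerm q r γ) ∘ Fin.natAdd q = (σ ∘ Fin.natAdd q) ∘ γ.2 := by
  funext i
  simp

theorem mem_unshuffles {σ : Perm (Fin (q + r))} :
    σ ∈ unshuffles q r ↔ StrictMono (σ ∘ Fin.castAdd r) ∧ StrictMono (σ ∘ Fin.natAdd q) := by
  simp only [unshuffles, Finset.mem_filter, Finset.mem_univ, true_and]
  exact Iff.rfl

theorem perm_eq_one_of_strictMono_comp {m : ℕ} {f : Fin m → Fin n} {α : Perm (Fin m)}
    (hf : StrictMono f) (hα : StrictMono (f ∘ α)) : α = 1 := by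
  have h : f ∘ α = f := (StrictMono.range_inj hα hf).mp (α.surjective.range_comp f)
  exact Equiv.ext fun i => hf.injective (congrFun h i)

theorem blockPerm_eq_one_of_mul_mem_unshuffles {σ : Perm (Fin (q + r))}
    {γ : Perm (Fin q) × Perm (Fin r)} (hσ : σ ∈ unshuffles q r)
    (hγ : σ * blockPerm q r γ ∈ unshuffles q r) : γ = 1 := by
  rw [mem_unshuffles] at hσ hγ
  rw [mul_blockPerm_comp_castAdd, mul_blockPerm_comp_natAdd] at hγ
  exact Prod.ext (perm_eq_one_of_strictMono_comp hσ.1 hγ.1)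
    (perm_eq_one_of_strictMono_comp hσ.2 hγ.2)

theorem exists_mul_blockPerm_mem_unshuffles (σ : Perm (Fin (q + r))) :
    ∃ γ, σ * blockPerm q r γ ∈ unshuffles q r := by
  have strictMono_sort {m : ℕ} {f : Fin m → Fin (q + r)} (hf : Function.Injective f) :
      StrictMono (f ∘ Tuple.sort f) :=
    (Tuple.monotone_sort f).strictMono_of_injective (hf.comp (Tuple.sort f).injective)
  refine ⟨(Tuple.sort (σ ∘ Fin.castAdd r), Tuple.sort (σ ∘ Fin.natAdd q)), mem_unshuffles.mpr ?_⟩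
  rw [mul_blockPerm_comp_castAdd, mul_blockPerm_comp_natAdd]
  exact ⟨strictMono_sort (σ.injective.comp (Fin.castAdd_injective q r)),
    strictMono_sort (σ.injective.comp (Fin.natAdd_injective r q))⟩

theorem sum_perm_eq_sum_unshuffles {M : Type*} [AddCommMonoid M] (F : Perm (Fin (q + r)) → M)
    (hF : ∀ σ γ, F (σ * blockPerm q r γ) = F σ) :
    ∑ σ, F σ = (q.factorial * r.factorial) • ∑ σ ∈ unshuffles q r, F σ := by
  have h : ∑ x ∈ unshuffles q r ×ˢ (Finset.univ : Finset (Perm (Fin q) × Perm (Fin r))),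
      F x.1 = ∑ σ, F σ := by
    refine Finset.sum_bij (fun x _ => x.1 * blockPerm q r x.2) (fun _ _ => Finset.mem_univ _)
      ?_ ?_ fun x _ => (hF _ _).symm
    · rintro ⟨σ, γ⟩ hσ ⟨σ', γ'⟩ hσ' he
      simp only [Finset.mem_product, Finset.mem_univ, and_true] at hσ hσ' he
      have hσσ' : σ * blockPerm q r (γ * γ'⁻¹) = σ' := by
        rw [map_mul, map_inv, ← mul_assoc, he, mul_inv_cancel_right]
      have hγ := blockPerm_eq_one_of_mul_mem_unshuffles hσ (hσσ'.symm ▸ hσ')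
      rw [hγ, map_one, mul_one] at hσσ'
      exact Prod.ext hσσ' (mul_inv_eq_one.mp hγ)
    · intro σ _
      obtain ⟨γ, hγ⟩ := exists_mul_blockPerm_mem_unshuffles σ
      refine ⟨(σ * blockPerm q r γ, γ⁻¹), by simpa using hγ, ?_⟩
      rw [map_inv, mul_inv_cancel_right]
  rw [← h, Finset.sum_product, Finset.smul_sum]
  exact Finset.sum_congr rfl fun σ _ => by simp [Fintype.card_perm]

theorem shuffleSum_comp_first {V M : Type*} [AddCommGroup M] (h : q + r = n)
    (G : (Fin q → V) → (Fin r → V) → M) (v : Fin n → V) (α : Perm (Fin q)) :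
    shuffleSum h (fun x y => G (x ∘ α) y) v = (Perm.sign α : ℤ) • shuffleSum h G v := by
  subst h
  have first (x : Fin (q + r) → V) :
      firstBlock rfl x ∘ α = firstBlock rfl (x ∘ blockPerm q r (α, 1)) := by
    funext i
    simp [firstBlock]
  have last (x : Fin (q + r) → V) :
      lastBlock rfl x = lastBlock rfl (x ∘ blockPerm q r (α, 1)) := by
    funext i
    simp [lastBlock]
  have hα : Perm.sign (blockPerm q r (α, 1)) = Perm.sign α := by simp [sign_blockPerm]
  rw [← hα, shuffleSum, shuffleSum, ← antisymmetrization_comp_perm]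
  simp only [first, ← last]

theorem shuffleSum_sum_removeNth {V M : Type*} [AddCommGroup M] (h : q + 1 + r = n)
    (G : V → (Fin q → V) → (Fin r → V) → M) (v : Fin n → V) :
    shuffleSum h
        (fun x y => ∑ l : Fin (q + 1), (-1 : ℤ) ^ (l : ℕ) • G (x l) (l.removeNth x) y) v =
      (q + 1) • shuffleSum h (fun x y => G (x 0) (Fin.tail x) y) v := by
  have summand (l : Fin (q + 1)) :
      shuffleSum h (fun x y => (-1 : ℤ) ^ (l : ℕ) • G (x l) (l.removeNth x) y) v =
        shuffleSum h (fun x y => G (x 0) (Fin.tail x) y) v := by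
    have key := shuffleSum_comp_first h (fun x y => G (x 0) (Fin.tail x) y) v l.cycleRange.symm
    simp only [← Fin.cons_removeNth_eq_comp_cycleRange_symm, Fin.cons_zero, Fin.tail_cons,
      Perm.sign_symm, Fin.sign_cycleRange, Units.val_pow_eq_pow_val, Units.val_neg,
      Units.val_one] at key
    rw [shuffleSum_smul, key, smul_smul, ← pow_add, Even.neg_one_pow ⟨_, rfl⟩, one_smul]
  simp only [shuffleSum_sum, summand, Finset.sum_const, Finset.card_univ, Fintype.card_fin]

end Unshuffles

section ShuffleProduct

variable {R V N M : Type*} [CommRing R] [AddCommGroup V] [AddCommGroup N] [AddCommGroup M]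
  [Module R V] [Module R N] [Module R M] {n q r : ℕ}

/-- The antisymmetrized composition `∑ ± L (a (v_σ(1), …, v_σ(q))) (v_σ(q+1), …, v_σ(n))`, summed
over all permutations; it is `q! r!` times the corresponding sum over unshuffles. -/
noncomputable def shuffleProduct (h : q + r = n) (a : V [⋀^Fin q]→ₗ[R] N)
    (L : N →ₗ[R] V [⋀^Fin r]→ₗ[R] M) : V [⋀^Fin n]→ₗ[R] M :=
  MultilinearMap.alternatization <|
    (((AlternatingMap.toMultilinearMapLM (S := R) ∘ₗ L).compMultilinearMap
      a.toMultilinearMap).uncurrySum.domDomCongr (finSumFinEquiv.trans (finCongr h)))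

theorem shuffleProduct_apply (h : q + r = n) (a : V [⋀^Fin q]→ₗ[R] N)
    (L : N →ₗ[R] V [⋀^Fin r]→ₗ[R] M) (v : Fin n → V) :
    shuffleProduct h a L v = shuffleSum h (fun x y => L (a x) y) v := by
  rw [shuffleProduct, MultilinearMap.alternatization_apply]
  rfl

theorem shuffleProduct_eq_sum_unshuffles (h : q + r = n) (a : V [⋀^Fin q]→ₗ[R] N)
    (L : N →ₗ[R] V [⋀^Fin r]→ₗ[R] M) (v : Fin n → V) :
    shuffleProduct h a L v = (q.factorial * r.factorial) •
      ∑ σ ∈ unshuffles q r, (Perm.sign σ : ℤ) •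
        L (a fun i => v (Fin.cast h (σ (Fin.castAdd r i))))
          fun j => v (Fin.cast h (σ (Fin.natAdd q j))) := by
  subst h
  rw [shuffleProduct_apply]
  refine sum_perm_eq_sum_unshuffles _ fun σ γ => ?_
  have first : firstBlock rfl (v ∘ (σ * blockPerm q r γ : Perm _)) =
      firstBlock rfl (v ∘ σ) ∘ γ.1 :=
    congrArg (v ∘ ·) (mul_blockPerm_comp_castAdd σ γ)
  have last : lastBlock rfl (v ∘ (σ * blockPerm q r γ : Perm _)) =
      lastBlock rfl (v ∘ σ) ∘ γ.2 :=
    congrArg (v ∘ ·) (mul_blockPerm_comp_natAdd σ γ)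
  have hsign : (Perm.sign (σ * blockPerm q r γ) : ℤ) * (Perm.sign γ.2 * Perm.sign γ.1) =
      Perm.sign σ := by
    rw [Perm.sign_mul, sign_blockPerm, mul_comm (Perm.sign γ.2 : ℤ), ← Units.val_mul,
      ← Units.val_mul, mul_assoc, Int.units_mul_self, mul_one]
  simp only [first, last, AlternatingMap.map_perm, Units.smul_def, map_zsmul,
    AlternatingMap.smul_apply, ← mul_smul]
  rw [hsign]

theorem shuffleProduct_cons_eq_sum (h : q + 1 + r = n + 1) (h' : q + r = n)
    (a : V [⋀^Fin (q + 1)]→ₗ[R] N) (L : N →ₗ[R] V [⋀^Fin r]→ₗ[R] M) (w : V) (u : Fin n → V) :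
    shuffleProduct h a L (Fin.cons w u) =
      (q + 1) • shuffleSum h' (fun x y => L (a.curryLeft w x) y) u +
      ∑ j : Fin r, (-1 : ℤ) ^ (q + 1 + j) • antisymmetrization (fun x =>
        L (a (firstBlock h ((Fin.cast h (Fin.natAdd (q + 1) j)).insertNth w x)))
          (lastBlock h ((Fin.cast h (Fin.natAdd (q + 1) j)).insertNth w x))) u := by
  have summand (j : Fin (q + 1)) : (-1 : ℤ) ^ (j : ℕ) •
      shuffleSum h' (fun x y => L (a (j.insertNth w x)) y) u =
        shuffleSum h' (fun x y => L (a.curryLeft w x) y) u := by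
    rw [← shuffleSum_smul]
    simp only [← AlternatingMap.smul_apply, ← map_zsmul, a.neg_one_pow_smul_map_insertNth]
    rfl
  rw [shuffleProduct_apply, shuffleSum_cons_eq_sum h h', Fintype.sum_congr _ _ summand,
    Finset.sum_const, Finset.card_univ, Fintype.card_fin]

theorem shuffleProduct_cons (h : q + 1 + (r + 1) = n + 1) (h₁ : q + (r + 1) = n)
    (h₂ : q + 1 + r = n) (a : V [⋀^Fin (q + 1)]→ₗ[R] N) (L : N →ₗ[R] V [⋀^Fin (r + 1)]→ₗ[R] M)
    (w : V) (u : Fin n → V) :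
    shuffleProduct h a L (Fin.cons w u) =
      (q + 1) • shuffleSum h₁ (fun x y => L (a.curryLeft w x) y) u +
        (-1 : ℤ) ^ (q + 1) • (r + 1) • shuffleSum h₂ (fun x y => (L (a x)).curryLeft w y) u := by
  have summand (j : Fin (r + 1)) : (-1 : ℤ) ^ (q + 1 + j) • antisymmetrization (fun x =>
        L (a (firstBlock h ((Fin.cast h (Fin.natAdd (q + 1) j)).insertNth w x)))
          (lastBlock h ((Fin.cast h (Fin.natAdd (q + 1) j)).insertNth w x))) u =
      (-1 : ℤ) ^ (q + 1) • shuffleSum h₂ (fun x y => (L (a x)).curryLeft w y) u := by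
    simp only [firstBlock_insertNth_natAdd h h₂, lastBlock_insertNth_natAdd h h₂]
    rw [pow_add, mul_smul, ← antisymmetrization_smul ((-1 : ℤ) ^ (j : ℕ))]
    simp only [AlternatingMap.neg_one_pow_smul_map_insertNth]
    rfl
  rw [shuffleProduct_cons_eq_sum h h₁, Fintype.sum_congr _ _ summand, Finset.sum_const,
    Finset.card_univ, Fintype.card_fin, smul_comm]

theorem shuffleProduct_cons_smul {A : Type*} [CommRing A] [Module A V] [Module A M]
    (h : q + 1 + r = n + 1) (h' : q + r = n) (a : V [⋀^Fin (q + 1)]→ₗ[R] N)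
    (L : N →ₗ[R] V [⋀^Fin r]→ₗ[R] M)
    (hL : ∀ z y j (f : A) w, L z (Function.update y j (f • w)) = f • L z (Function.update y j w))
    (f : A) (w : V) (u : Fin n → V) :
    shuffleProduct h a L (Fin.cons (f • w) u) =
      f • shuffleProduct h a L (Fin.cons w u) + (q + 1) • shuffleSum h' (fun x y =>
        L (a.curryLeft (f • w) x) y - f • L (a.curryLeft w x) y) u := by
  have summand (j : Fin r) (x : Fin n → V) :
      L (a (firstBlock h ((Fin.cast h (Fin.natAdd (q + 1) j)).insertNth (f • w) x)))
          (lastBlock h ((Fin.cast h (Fin.natAdd (q + 1) j)).insertNth (f • w) x)) =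
        f • L (a (firstBlock h ((Fin.cast h (Fin.natAdd (q + 1) j)).insertNth w x)))
          (lastBlock h ((Fin.cast h (Fin.natAdd (q + 1) j)).insertNth w x)) := by
    have update_eq (w' : V) := Fin.update_insertNth (α := fun _ => V)
      (Fin.cast h (Fin.natAdd (q + 1) j)) w w' x
    rw [← update_eq, ← update_eq w, firstBlock_update_natAdd, firstBlock_update_natAdd,
      lastBlock_update_natAdd, lastBlock_update_natAdd, hL, Function.update_idem]
  simp only [shuffleProduct_cons_eq_sum h h', summand, antisymmetrization_smul, shuffleSum_sub,
    shuffleSum_smul, smul_sub, smul_add, Finset.smul_sum, smul_comm f]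
  abel

end ShuffleProduct

section AlternatingMap

variable {R V M : Type*} [CommRing R] [AddCommGroup V] [AddCommGroup M] [Module R V] [Module R M]
  {n : ℕ}

theorem alternatingMap_snoc_eq_smul_curryLeft (f : V [⋀^Fin (n + 1)]→ₗ[R] M) (v : Fin n → V)
    (w : V) : f (Fin.snoc v w) = (-1 : ℤ) ^ n • f.curryLeft w v := by
  rw [← Fin.insertNth_last', f.map_insertNth, Fin.val_last]
  rfl

/-- An alternating map as an alternating map of all its arguments but the last, with values in the
linear maps of the last one. -/
def curryLast (f : V [⋀^Fin (n + 1)]→ₗ[R] M) : V [⋀^Fin n]→ₗ[R] (V →ₗ[R] M) :=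
  { f.toMultilinearMap.curryRight with
    map_eq_zero_of_eq' := fun v i j hij hne => LinearMap.ext fun w =>
      f.map_eq_zero_of_eq (Fin.snoc v w) (i := i.castSucc) (j := j.castSucc)
        (by simpa only [Fin.snoc_castSucc] using hij) (by simpa using hne) }

theorem curryLast_apply (f : V [⋀^Fin (n + 1)]→ₗ[R] M) (v : Fin n → V) (w : V) :
    curryLast f v w = f (Fin.snoc v w) := rfl

theorem curryLast_removeNth (f : V [⋀^Fin (n + 1)]→ₗ[R] M) (i : Fin (n + 1))
    (v : Fin (n + 1) → V) :
    curryLast f (i.removeNth v) (v i) = (-1 : ℤ) ^ n • (-1 : ℤ) ^ (i : ℕ) • f v := by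
  rw [curryLast_apply, alternatingMap_snoc_eq_smul_curryLeft]
  conv_rhs => rw [← Fin.insertNth_self_removeNth i v, f.neg_one_pow_smul_map_insertNth]
  rfl

theorem alternatingMap_curryLeft_curryLeft_swap (f : V [⋀^Fin (n + 2)]→ₗ[R] M) (z w : V) :
    (f.curryLeft z).curryLeft w = -(f.curryLeft w).curryLeft z := by
  have h := f.curryLeft_same (z + w)
  simp only [map_add, AlternatingMap.curryLeft_add, LinearMap.add_apply,
    AlternatingMap.curryLeft_same, zero_add, add_zero] at h
  exact eq_neg_of_add_eq_zero_right h

theorem multilinearMap_eq_zero_of_span_range {A ι : Type*} [CommRing A] [Module A V] [Module A M]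
    {g : ι → V} (hg : Submodule.span A (Set.range g) = ⊤)
    (T : MultilinearMap R (fun _ : Fin n => V) M)
    (hT : ∀ v i (a : A) w, T (Function.update v i (a • w)) = a • T (Function.update v i w))
    (hzero : ∀ a : Fin n → ι, T (fun i => g (a i)) = 0) : T = 0 := by
  have zero_off (t : Finset (Fin n)) : ∀ v, (∀ i ∉ t, v i ∈ Set.range g) → T v = 0 := by
    induction t using Finset.induction_on with
    | empty =>
      intro v hv
      choose a ha using fun i => hv i (Finset.notMem_empty i)
      simpa only [ha] using hzero a
    | insert i t _ ih =>
      intro v hv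
      let slot : V →ₗ[A] M :=
        { toFun w := T (Function.update v i w)
          map_add' := T.map_update_add v i
          map_smul' := hT v i }
      have slot_eq_zero : slot = 0 := LinearMap.ext_on hg fun w hw => by
        refine ih _ fun j hj => ?_
        rcases eq_or_ne j i with rfl | hji
        · rwa [Function.update_self]
        · rw [Function.update_of_ne hji]
          exact hv j (by simp [hji, hj])
      simpa [slot] using LinearMap.congr_fun slot_eq_zero (v i)
  exact MultilinearMap.ext fun v =>
    zero_off Finset.univ v fun i hi => absurd (Finset.mem_univ i) hi

theorem alternatingMap_eq_zero_of_span_range {A ι : Type*} [CommRing A] [Module A V] [Module A M]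
    {g : ι → V} (hg : Submodule.span A (Set.range g) = ⊤) (T : V [⋀^Fin (n + 1)]→ₗ[R] M)
    (hT : ∀ (a : A) w u, T (Fin.cons (a • w) u) = a • T (Fin.cons w u))
    (hzero : ∀ a : Fin (n + 1) → ι, T (fun i => g (a i)) = 0) : T = 0 := by
  refine AlternatingMap.coe_multilinearMap_injective <|
    multilinearMap_eq_zero_of_span_range hg T.toMultilinearMap (fun v i a w => ?_) hzero
  simp only [AlternatingMap.coe_multilinearMap, ← Fin.insertNth_removeNth, T.map_insertNth]
  rw [smul_comm a]
  exact congrArg _ (hT a w _)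

/-- Restriction of scalars along `R → A` of an alternating map. -/
def alternatingRestrictScalars (R : Type*) {A V M : Type*} [CommRing R] [CommRing A] [Algebra R A]
    [AddCommGroup V] [AddCommGroup M] [Module A V] [Module A M] [Module R V] [Module R M]
    [IsScalarTower R A V] [IsScalarTower R A M] {n : ℕ} (f : V [⋀^Fin n]→ₗ[A] M) :
    V [⋀^Fin n]→ₗ[R] M :=
  { f.toMultilinearMap.restrictScalars R with
    map_eq_zero_of_eq' := f.map_eq_zero_of_eq' }

end AlternatingMap

section Jacobiator

variable {k A V : Type*} [Field k] [CommRing A] [Algebra k A] [AddCommGroup V] [Module A V]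
  [Module k V] {p : ℕ}

/-- The defect of the Jacobi identity: `∑ ± [[v₁, …, vₘ], vₘ₊₁, …, v₂ₘ₋₁]` over all
permutations. -/
noncomputable def jacobiator (β : V [⋀^Fin (p + 2)]→ₗ[k] V) : V [⋀^Fin (2 * p + 2 + 1)]→ₗ[k] V :=
  shuffleProduct (q := p + 1 + 1) (r := p + 1) (by omega) β β.curryLeft

theorem jacobiator_apply_eq_sum_removeNth (h : p + 1 + (p + 1) = 2 * p + 2)
    (β : V [⋀^Fin (p + 2)]→ₗ[k] V) (v : Fin (2 * p + 2 + 1) → V) :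
    jacobiator β v = ∑ i : Fin (2 * p + 2 + 1), (-1 : ℤ) ^ (i : ℕ) •
      shuffleSum h (fun x y => β.curryLeft (β.curryLeft (v i) x) y) (i.removeNth v) := by
  have cons_head_tail (x : Fin (p + 2) → V) : β x = β.curryLeft (x 0) (Fin.tail x) :=
    congrArg β (Fin.cons_self_tail x).symm
  rw [jacobiator, shuffleProduct_apply]
  simp only [cons_head_tail]
  exact shuffleSum_eq_sum_removeNth (q := p + 1) (r := p + 1) _ h
    (fun b x y => β.curryLeft (β.curryLeft b x) y) v

/-- The Leibniz rule `[v₁, …, vₘ₋₁, a w] = a [v₁, …, vₘ₋₁, w] + ρ (v₁, …, vₘ₋₁, a) w`. -/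
def IsAnchor (β : V [⋀^Fin (p + 2)]→ₗ[k] V) (ρ : V [⋀^Fin (p + 1)]→ₗ[A] (A →ₗ[k] A)) : Prop :=
  ∀ (v : Fin (p + 1) → V) (a : A) (w : V),
    β (Fin.snoc v (a • w)) = a • β (Fin.snoc v w) + ρ v a • w

theorem isAnchor_iff_curryLeft (hp : Even p) {β : V [⋀^Fin (p + 2)]→ₗ[k] V}
    {ρ : V [⋀^Fin (p + 1)]→ₗ[A] (A →ₗ[k] A)} :
    IsAnchor β ρ ↔ ∀ (v : Fin (p + 1) → V) (a : A) (w : V),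
      β.curryLeft (a • w) v = a • β.curryLeft w v - ρ v a • w := by
  simp only [IsAnchor, alternatingMap_snoc_eq_smul_curryLeft, hp.add_one.neg_one_pow, neg_smul,
    one_smul, smul_neg]
  refine forall₃_congr fun v a w => ?_
  rw [neg_eq_iff_eq_neg, neg_add, neg_neg, sub_eq_add_neg]

variable [IsScalarTower k A V]

/-- The anchor `ρ (v₁, …, vₙ, f)` as an alternating map of the `vᵢ`, depending linearly on `f`. -/
def anchorAt {n : ℕ} (ρ : V [⋀^Fin n]→ₗ[A] (A →ₗ[k] A)) : A →ₗ[k] V [⋀^Fin n]→ₗ[k] A where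
  toFun f := alternatingRestrictScalars k ((LinearMap.applyₗ' A f).compAlternatingMap ρ)
  map_add' f g := AlternatingMap.ext fun v => map_add (ρ v) f g
  map_smul' c f := AlternatingMap.ext fun v => map_smul (ρ v) c f

@[simp]
theorem anchorAt_apply {n : ℕ} (ρ : V [⋀^Fin n]→ₗ[A] (A →ₗ[k] A)) (f : A) (v : Fin n → V) :
    anchorAt ρ f v = ρ v f := rfl

/-- The defect of the compatibility of the anchor with the bracket. The coefficients come from
summing over all permutations: up to the common factor `m! (m - 1)!` they turn the two sums into
sums over unshuffles. -/
noncomputable def anchorDefect (β : V [⋀^Fin (p + 2)]→ₗ[k] V)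
    (ρ : V [⋀^Fin (p + 1)]→ₗ[A] (A →ₗ[k] A)) (f : A) : V [⋀^Fin (2 * p + 1 + 1)]→ₗ[k] A :=
  (p + 1) • shuffleProduct (q := p + 1 + 1) (r := p) (by omega) β (anchorAt ρ f).curryLeft +
    (p + 2) • shuffleProduct (q := p + 1) (r := p + 1) (by omega) (anchorAt ρ f) (anchorAt ρ)

variable {β : V [⋀^Fin (p + 2)]→ₗ[k] V} {ρ : V [⋀^Fin (p + 1)]→ₗ[A] (A →ₗ[k] A)}

theorem anchorDefect_cons_smul (hp : Even p) (hβ : IsAnchor β ρ)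
    (hρ : ∀ v (a b : A), ρ v (a * b) = a * ρ v b + b * ρ v a)
    (f g : A) (w : V) (u : Fin (2 * p + 1) → V) :
    anchorDefect β ρ f (Fin.cons (g • w) u) = g • anchorDefect β ρ f (Fin.cons w u) := by
  rw [isAnchor_iff_curryLeft hp] at hβ
  have smul_curryLeft (z y j) (a : A) (x : V) :
      (anchorAt ρ f).curryLeft z (Function.update y j (a • x)) =
        a • (anchorAt ρ f).curryLeft z (Function.update y j x) :=
    LinearMap.congr_fun ((ρ.curryLeft z).map_update_smul y j a x) f
  have smul_anchorAt (z y j) (a : A) (x : V) :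
      anchorAt ρ z (Function.update y j (a • x)) = a • anchorAt ρ z (Function.update y j x) :=
    LinearMap.congr_fun (ρ.map_update_smul y j a x) z
  have bracket_defect (x : Fin (p + 1) → V) (y : Fin p → V) :
      (anchorAt ρ f).curryLeft (β.curryLeft (g • w) x) y -
          g • (anchorAt ρ f).curryLeft (β.curryLeft w x) y =
        -(ρ x g * ρ.curryLeft w y f) := by
    change ρ.curryLeft (β.curryLeft (g • w) x) y f - g • ρ.curryLeft (β.curryLeft w x) y f = _
    simp [hβ]
  have anchor_defect (x : Fin p → V) (y : Fin (p + 1) → V) :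
      anchorAt ρ ((anchorAt ρ f).curryLeft (g • w) x) y -
          g • anchorAt ρ ((anchorAt ρ f).curryLeft w x) y =
        ρ y g * ρ.curryLeft w x f := by
    change ρ y (ρ.curryLeft (g • w) x f) - g • ρ y (ρ.curryLeft w x f) = _
    simp [hρ, mul_comm]
  have swap : shuffleSum (q := p) (r := p + 1) (n := 2 * p + 1) (by omega)
      (fun x y => ρ y g * ρ.curryLeft w x f) u =
      shuffleSum (q := p + 1) (r := p) (by omega) (fun x y => ρ x g * ρ.curryLeft w y f) u := by
    rw [shuffleSum_swap_blocks (q := p + 1) (r := p) (by omega) (by omega)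
      (fun x y => ρ x g * ρ.curryLeft w y f), Even.neg_one_pow (hp.mul_left _), one_smul]
  simp only [anchorDefect, AlternatingMap.add_apply, AlternatingMap.smul_apply]
  rw [shuffleProduct_cons_smul (q := p + 1) (r := p) (by omega) (by omega) _ _ smul_curryLeft,
    shuffleProduct_cons_smul (q := p) (r := p + 1) (by omega) (by omega) _ _ smul_anchorAt]
  simp only [bracket_defect, anchor_defect, swap, shuffleSum_neg]
  module

theorem jacobiator_cons_smul (hp : Even p) (hβ : IsAnchor β ρ) (f : A) (w : V)
    (u : Fin (2 * p + 2) → V) :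
    jacobiator β (Fin.cons (f • w) u) =
      f • jacobiator β (Fin.cons w u) + anchorDefect β ρ f u • w := by
  rw [isAnchor_iff_curryLeft hp] at hβ
  have inner (x y : Fin (p + 1) → V) : β.curryLeft (β.curryLeft (f • w) x) y =
      f • β.curryLeft (β.curryLeft w x) y - ρ y f • β.curryLeft w x - ρ x f • β.curryLeft w y +
        ρ y (ρ x f) • w := by
    simp only [hβ, map_sub, AlternatingMap.sub_apply]
    module
  have outer (z : V) (y : Fin p → V) : (β.curryLeft z).curryLeft (f • w) y =
      f • (β.curryLeft z).curryLeft w y + (anchorAt ρ f).curryLeft z y • w := by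
    have h := hβ (Fin.cons z y) f w
    rw [alternatingMap_curryLeft_curryLeft_swap, alternatingMap_curryLeft_curryLeft_swap β z w,
      AlternatingMap.neg_apply, AlternatingMap.neg_apply, smul_neg, neg_eq_iff_eq_neg, neg_add,
      neg_neg, ← sub_eq_add_neg]
    exact h
  have swap : shuffleSum (q := p + 1) (r := p + 1) (n := 2 * p + 2) (by omega)
      (fun x y => ρ y f • β.curryLeft w x) u =
      -shuffleSum (q := p + 1) (r := p + 1) (by omega) (fun x y => ρ x f • β.curryLeft w y) u := by
    rw [shuffleSum_swap_blocks (q := p + 1) (r := p + 1) (by omega) (by omega)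
      (fun x y => ρ x f • β.curryLeft w y), Odd.neg_one_pow (hp.add_one.mul hp.add_one),
      neg_smul, one_smul]
  rw [jacobiator, shuffleProduct_cons _ (by omega) (by omega),
    shuffleProduct_cons _ (by omega) (by omega)]
  simp only [anchorDefect, AlternatingMap.add_apply, AlternatingMap.smul_apply,
    shuffleProduct_apply, anchorAt_apply, inner, outer, shuffleSum_add, shuffleSum_sub,
    shuffleSum_smul, swap, shuffleSum_smul_const, hp.add_one.add_one.neg_one_pow]
  module

theorem jacobiator_comp_cast (v : Fin (p + 2 + (p + 1)) → V) :
    jacobiator β (v ∘ Fin.cast (by omega)) = ((p + 2).factorial * (p + 1).factorial) •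
      ∑ σ ∈ unshuffles (p + 2) (p + 1), (Perm.sign σ : ℤ) •
        β (Fin.cons (β fun i => v (σ (Fin.castAdd (p + 1) i)))
          fun j => v (σ (Fin.natAdd (p + 2) j))) :=
  shuffleProduct_eq_sum_unshuffles _ _ _ _

theorem anchorDefect_comp_cast (v : Fin (p + 1 + (p + 1)) → V) (a : A) :
    anchorDefect β ρ a (v ∘ Fin.cast (by omega)) = ((p + 2).factorial * (p + 1).factorial) •
      (∑ σ ∈ unshuffles (p + 2) p, (Perm.sign σ : ℤ) •
          ρ (Fin.cons
            (β fun i => v (Fin.cast (by omega) (σ (Fin.castAdd p i))))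
            fun j => v (Fin.cast (by omega) (σ (Fin.natAdd (p + 2) j)))) a +
        ∑ σ ∈ unshuffles (p + 1) (p + 1), (Perm.sign σ : ℤ) •
          ρ (fun j => v (σ (Fin.natAdd (p + 1) j)))
            (ρ (fun i => v (σ (Fin.castAdd (p + 1) i))) a)) := by
  have bracket_coeff : (p + 1) * ((p + 1 + 1).factorial * p.factorial) =
      (p + 2).factorial * (p + 1).factorial := by
    rw [Nat.factorial_succ p, mul_left_comm]
  have anchor_coeff : (p + 2) * ((p + 1).factorial * (p + 1).factorial) =
      (p + 2).factorial * (p + 1).factorial := by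
    rw [Nat.factorial_succ (p + 1), mul_assoc]
  rw [anchorDefect, AlternatingMap.add_apply, AlternatingMap.smul_apply,
    AlternatingMap.smul_apply, shuffleProduct_eq_sum_unshuffles, shuffleProduct_eq_sum_unshuffles,
    smul_smul, smul_smul, bracket_coeff, anchor_coeff, ← smul_add]
  rfl

/-- The Lie-Rinehart `m`-algebra given by a bracket and an anchor satisfying the Leibniz rules,
whose remaining axioms are verified on generators of the module only. -/
def LieRinehartMAlgebra.ofSpanRange {ι : Type*} (hp : Even p) (hk : ((p + 2).factorial : k) ≠ 0)
    {g : ι → V} (hg : Submodule.span A (Set.range g) = ⊤) (β : V [⋀^Fin (p + 2)]→ₗ[k] V)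
    (ρ : V [⋀^Fin (p + 1)]→ₗ[A] (A →ₗ[k] A)) (hβ : IsAnchor β ρ)
    (hρ : ∀ v (a b : A), ρ v (a * b) = a * ρ v b + b * ρ v a)
    (hdefect : ∀ f (a : Fin (2 * p + 1 + 1) → ι), anchorDefect β ρ f (fun i => g (a i)) = 0)
    (hjacobiator : ∀ a : Fin (2 * p + 2 + 1) → ι, jacobiator β (fun i => g (a i)) = 0) :
    LieRinehartMAlgebra k A V p :=
  have hk' : (((p + 2).factorial * (p + 1).factorial : ℕ) : k) ≠ 0 := by
    rw [Nat.factorial_succ (p + 1), Nat.cast_mul] at hk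
    rw [Nat.factorial_succ (p + 1), Nat.cast_mul, Nat.cast_mul]
    exact mul_ne_zero hk (right_ne_zero_of_mul hk)
  have defect_eq_zero (f : A) : anchorDefect β ρ f = 0 :=
    alternatingMap_eq_zero_of_span_range hg _ (anchorDefect_cons_smul hp hβ hρ f) (hdefect f)
  have jacobiator_eq_zero : jacobiator β = 0 := alternatingMap_eq_zero_of_span_range hg _
    (fun a w u => by
      rw [jacobiator_cons_smul hp hβ, defect_eq_zero, AlternatingMap.zero_apply, zero_smul,
        add_zero])
    hjacobiator
  { bracket := β
    anchor := ρ
    bracket_leibniz := hβ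
    anchor_leibniz := hρ
    jacobi v := by
      have h := jacobiator_comp_cast (β := β) v
      rw [jacobiator_eq_zero, AlternatingMap.zero_apply, ← Nat.cast_smul_eq_nsmul k] at h
      exact (smul_eq_zero.mp h.symm).resolve_left hk'
    anchor_bracket v a := by
      have h := anchorDefect_comp_cast (β := β) (ρ := ρ) v a
      rw [defect_eq_zero, AlternatingMap.zero_apply, ← Nat.cast_smul_eq_nsmul k] at h
      exact (smul_eq_zero.mp h.symm).resolve_left hk' }

theorem LieRinehartMAlgebra.ext_of_span_range {ι : Type*} {g : ι → V}
    (hg : Submodule.span A (Set.range g) = ⊤) {L L' : LieRinehartMAlgebra k A V p}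
    (hbracket : ∀ a : Fin (p + 2) → ι,
      L.bracket (fun i => g (a i)) = L'.bracket (fun i => g (a i)))
    (hanchor : ∀ a : Fin (p + 1) → ι,
      L.anchor (fun i => g (a i)) = L'.anchor (fun i => g (a i))) : L = L' := by
  have anchor_eq : L.anchor = L'.anchor := sub_eq_zero.mp <|
    alternatingMap_eq_zero_of_span_range hg _
      (fun a w u => DFunLike.congr_fun (map_smul (L.anchor - L'.anchor).curryLeft a w) u)
      fun a => sub_eq_zero.mpr (hanchor a)
  have snoc_smul (u) (a : A) (w : V) : (L.bracket - L'.bracket) (Fin.snoc u (a • w)) =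
      a • (L.bracket - L'.bracket) (Fin.snoc u w) := by
    rw [AlternatingMap.sub_apply, AlternatingMap.sub_apply, L.bracket_leibniz,
      L'.bracket_leibniz, anchor_eq, add_sub_add_right_eq_sub, ← smul_sub]
  refine LieRinehartMAlgebra.ext (sub_eq_zero.mp ?_) anchor_eq
  refine alternatingMap_eq_zero_of_span_range hg _ (fun a w u => ?_)
    fun a => sub_eq_zero.mpr (hbracket a)
  have h := snoc_smul u a w
  rw [alternatingMap_snoc_eq_smul_curryLeft, alternatingMap_snoc_eq_smul_curryLeft,
    smul_comm a] at h
  exact ((isUnit_neg_one.pow _).smul_left_cancel).mp h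

end Jacobiator

section LieDerivative

open KaehlerDifferential

variable {k A : Type*} [CommRing k] [CommRing A] [Algebra k A]

/-- Pairs of differentials, with `A` acting through the homomorphism `a ↦ a + ε X a` to the dual
numbers. A derivation of `A` with values in pairs of this kind is a first-order deformation, along
`X`, of its first component. -/
def TwistedPair (_X : Derivation k A A) : Type _ := Ω[A⁄k] × Ω[A⁄k]

namespace TwistedPair

variable (X : Derivation k A A)

noncomputable instance : AddCommGroup (TwistedPair X) :=
  inferInstanceAs (AddCommGroup (Ω[A⁄k] × Ω[A⁄k]))

noncomputable instance : Module k (TwistedPair X) :=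
  inferInstanceAs (Module k (Ω[A⁄k] × Ω[A⁄k]))

noncomputable instance : SMul A (TwistedPair X) where
  smul a x := (a • x.1, a • x.2 + X a • x.1)

theorem smul_def (a : A) (x : TwistedPair X) : a • x = (a • x.1, a • x.2 + X a • x.1) := rfl

noncomputable instance : Module A (TwistedPair X) :=
  Module.ofMinimalAxioms
    (fun a x y => Prod.ext (smul_add a x.1 y.1) <| by
      change a • (x.2 + y.2) + X a • (x.1 + y.1) = (a • x.2 + X a • x.1) + (a • y.2 + X a • y.1)
      module)
    (fun a b x => Prod.ext (add_smul a b x.1) <| by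
      change (a + b) • x.2 + X (a + b) • x.1 = (a • x.2 + X a • x.1) + (b • x.2 + X b • x.1)
      rw [map_add]
      module)
    (fun a b x => Prod.ext (mul_smul a b x.1) <| by
      change (a * b) • x.2 + X (a * b) • x.1 = a • (b • x.2 + X b • x.1) + X a • b • x.1
      rw [X.leibniz, smul_eq_mul, smul_eq_mul]
      module)
    (fun x => Prod.ext (one_smul A x.1) <| by
      change (1 : A) • x.2 + X 1 • x.1 = x.2
      rw [X.map_one_eq_zero, one_smul, zero_smul, add_zero])

instance : IsScalarTower k A (TwistedPair X) where
  smul_assoc c a x := Prod.ext (smul_assoc c a x.1) <| by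
    change (c • a) • x.2 + X (c • a) • x.1 = c • (a • x.2 + X a • x.1)
    rw [X.map_smul, smul_assoc, smul_assoc, smul_add]

/-- The derivation `b ↦ db + ε d(X b)`, the deformation of `d` along `X`. -/
noncomputable def derivation : Derivation k A (TwistedPair X) :=
  Derivation.mk' ((D k A).toLinearMap.prod ((D k A).toLinearMap ∘ₗ X.toLinearMap)) fun b c => by
    refine Prod.ext ((D k A).leibniz b c) ?_
    change D k A (X (b * c)) =
      (b • D k A (X c) + X b • D k A c) + (c • D k A (X b) + X c • D k A b)
    simp only [Derivation.leibniz, smul_eq_mul, map_add]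
    module

end TwistedPair

theorem induction_smul_D {C : Ω[A⁄k] → Prop} (ω : Ω[A⁄k]) (hD : ∀ b, C (D k A b))
    (hadd : ∀ ω η, C ω → C η → C (ω + η)) (hsmul : ∀ (a : A) ω, C ω → C (a • ω)) : C ω := by
  have hω : ω ∈ Submodule.span A (Set.range (D k A)) :=
    span_range_derivation k A ▸ Submodule.mem_top
  induction hω using Submodule.span_induction with
  | mem x hx => obtain ⟨b, rfl⟩ := hx; exact hD b
  | zero => simpa using hD 0
  | add x y _ _ hx hy => exact hadd x y hx hy
  | smul a x _ hx => exact hsmul a x hx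

/-- The Lie derivative of Kähler differentials along a derivation. -/
noncomputable def lieDerivative (X : Derivation k A A) : Ω[A⁄k] →ₗ[k] Ω[A⁄k] :=
  LinearMap.snd k Ω[A⁄k] Ω[A⁄k] ∘ₗ
    ((TwistedPair.derivation X).liftKaehlerDifferential.restrictScalars k :
      Ω[A⁄k] →ₗ[k] TwistedPair X)

theorem lieDerivative_D (X : Derivation k A A) (b : A) :
    lieDerivative X (D k A b) = D k A (X b) :=
  congrArg Prod.snd ((TwistedPair.derivation X).liftKaehlerDifferential_comp_D b)

theorem TwistedPair.fst_lift_derivation (X : Derivation k A A) (ω : Ω[A⁄k]) :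
    Prod.fst ((derivation X).liftKaehlerDifferential ω : Ω[A⁄k] × Ω[A⁄k]) = ω := by
  induction ω using induction_smul_D with
  | hD b => rw [Derivation.liftKaehlerDifferential_comp_D]; rfl
  | hadd ω η hω hη => rw [map_add]; exact congrArg₂ (· + ·) hω hη
  | hsmul a ω hω => rw [map_smul]; exact congrArg (a • ·) hω

theorem lieDerivative_smul (X : Derivation k A A) (a : A) (ω : Ω[A⁄k]) :
    lieDerivative X (a • ω) = a • lieDerivative X ω + X a • ω := by
  have h := congrArg Prod.snd ((TwistedPair.derivation X).liftKaehlerDifferential.map_smul a ω)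
  rwa [TwistedPair.smul_def, TwistedPair.fst_lift_derivation] at h

theorem lieDerivative_add_left (X Y : Derivation k A A) (ω : Ω[A⁄k]) :
    lieDerivative (X + Y) ω = lieDerivative X ω + lieDerivative Y ω := by
  induction ω using induction_smul_D with
  | hD b => simp only [lieDerivative_D, Derivation.add_apply, map_add]
  | hadd ω η hω hη => simp only [map_add, hω, hη]; abel
  | hsmul a ω hω => simp only [lieDerivative_smul, hω, Derivation.add_apply]; module

theorem lieDerivative_smul_left (f : A) (X : Derivation k A A) (ω : Ω[A⁄k]) :
    lieDerivative (f • X) ω = f • lieDerivative X ω + X.liftKaehlerDifferential ω • D k A f := by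
  induction ω using induction_smul_D with
  | hD b =>
    simp only [lieDerivative_D, Derivation.smul_apply, Derivation.liftKaehlerDifferential_comp_D,
      smul_eq_mul, Derivation.leibniz]
  | hadd ω η hω hη => simp only [map_add, hω, hη]; module
  | hsmul a ω hω =>
    simp only [lieDerivative_smul, hω, Derivation.smul_apply, map_smul, smul_eq_mul]; module

theorem lieDerivative_smul_left_of_base (c : k) (X : Derivation k A A) (ω : Ω[A⁄k]) :
    lieDerivative (c • X) ω = c • lieDerivative X ω := by
  have h := lieDerivative_smul_left (algebraMap k A c) X ω
  rwa [Derivation.map_algebraMap, smul_zero, add_zero, algebraMap_smul, algebraMap_smul] at h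

/-- The Lie derivative as a `k`-bilinear map of the differential and the derivation. -/
noncomputable def lieDerivativeBilin : Ω[A⁄k] →ₗ[k] Derivation k A A →ₗ[k] Ω[A⁄k] :=
  LinearMap.mk₂ k (fun ω X => lieDerivative X ω) (fun ω η X => map_add (lieDerivative X) ω η)
    (fun c ω X => map_smul (lieDerivative X) c ω) (fun ω X Y => lieDerivative_add_left X Y ω)
    fun c ω X => lieDerivative_smul_left_of_base c X ω

end LieDerivative

section Multiderivation

open KaehlerDifferential

variable {k A M : Type*} [CommRing k] [CommRing A] [Algebra k A] [AddCommGroup M] [Module A M]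
  {n : ℕ}

theorem multilinearMap_eq_of_forall_D {F G : MultilinearMap A (fun _ : Fin n => Ω[A⁄k]) M}
    (h : ∀ a : Fin n → A, F (fun i => D k A (a i)) = G (fun i => D k A (a i))) : F = G :=
  sub_eq_zero.mp <| multilinearMap_eq_zero_of_span_range (span_range_derivation k A) _
    (F - G).map_update_smul fun a => sub_eq_zero.mpr (h a)

variable [Module k M]

/-- `f` is a derivation in each of its arguments. -/
def IsMultiderivation (f : MultilinearMap k (fun _ : Fin n => A) M) : Prop :=
  ∀ (v : Fin n → A) (i : Fin n) (b c : A), f (Function.update v i (b * c)) =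
    b • f (Function.update v i c) + c • f (Function.update v i b)

theorem IsMultiderivation.curryLeft {f : MultilinearMap k (fun _ : Fin (n + 1) => A) M}
    (hf : IsMultiderivation f) (a : A) : IsMultiderivation (f.curryLeft a) := fun v i b c => by
  simpa only [MultilinearMap.curryLeft_apply, Fin.cons_update] using hf (Fin.cons a v) i.succ b c

theorem multilinearMap_eq_zero_of_eq_of_D (f : A [⋀^Fin n]→ₗ[k] M)
    {F : MultilinearMap A (fun _ : Fin n => Ω[A⁄k]) M}
    (hF : ∀ a : Fin n → A, F (fun i => D k A (a i)) = f a) {v : Fin n → Ω[A⁄k]} {i j : Fin n}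
    (hij : v i = v j) (hne : i ≠ j) : F v = 0 := by
  have exists_coeff (ω : Ω[A⁄k]) : ∃ c : A →₀ A, c.sum (fun b a => a • D k A b) = ω := by
    have h : ω ∈ Submodule.span A (Set.range (D k A)) :=
      span_range_derivation k A ▸ Submodule.mem_top
    exact Finsupp.mem_span_range_iff_exists_finsupp.mp h
  choose c hc using exists_coeff
  have expansion : F v = ∑ r ∈ Fintype.piFinset fun l => (c (v l)).support,
      (∏ l, c (v l) (r l)) • f r := by
    conv_lhs => rw [← funext fun l => hc (v l)]
    simp only [Finsupp.sum, F.map_sum_finset, F.map_smul_univ, hF]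
  rw [expansion]
  refine Finset.sum_involution (fun r _ => r ∘ swap i j) (fun r _ => ?_) (fun r _ hr hfix => ?_)
    (fun r hr => ?_) fun r _ => ?_
  · rw [f.map_swap r hne, smul_neg, ← Equiv.prod_comp (swap i j) fun l => c (v l) (r l)]
    simp [apply_swap_eq_self hij]
  · exact hr (by rw [f.map_eq_zero_of_eq r (by simpa using (congrFun hfix j)) hne, smul_zero])
  · simp only [Fintype.mem_piFinset] at hr ⊢
    intro l
    rw [← apply_swap_eq_self hij]
    exact hr (swap i j l)
  · funext l
    simp

variable [IsScalarTower k A M]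

theorem IsMultiderivation.exists_multilinearMap_D
    {f : MultilinearMap k (fun _ : Fin n => A) M} (hf : IsMultiderivation f) :
    ∃ F : MultilinearMap A (fun _ : Fin n => Ω[A⁄k]) M, ∀ a, F (fun i => D k A (a i)) = f a := by
  induction n with
  | zero =>
    exact ⟨MultilinearMap.constOfIsEmpty A _ (f 0), fun a => congrArg f (Subsingleton.elim _ _)⟩
  | succ n ih =>
    choose F hF using fun a => ih (hf.curryLeft a)
    have : IsScalarTower k A (MultilinearMap A (fun _ : Fin n => Ω[A⁄k]) M) :=
      ⟨fun c a G => MultilinearMap.ext fun v => smul_assoc c a (G v)⟩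
    let δ : Derivation k A (MultilinearMap A (fun _ : Fin n => Ω[A⁄k]) M) :=
      Derivation.mk'
        { toFun := F
          map_add' a a' := multilinearMap_eq_of_forall_D fun b => by
            simp only [add_apply, hF, map_add]
          map_smul' c a := multilinearMap_eq_of_forall_D fun b => by
            simp only [smul_apply, hF, map_smul, RingHom.id_apply] }
        fun a a' => multilinearMap_eq_of_forall_D fun b => by
          change F (a * a') _ = a • F a' _ + a' • F a _
          simpa only [hF, MultilinearMap.curryLeft_apply, Fin.update_cons_zero] using
            hf (Fin.cons 0 b) 0 a a'
    refine ⟨δ.liftKaehlerDifferential.uncurryLeft, fun a => ?_⟩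
    change δ.liftKaehlerDifferential (D k A (a 0)) (fun i => D k A (a i.succ)) = f a
    rw [Derivation.liftKaehlerDifferential_comp_D]
    exact (hF (a 0) _).trans (congrArg f (Fin.cons_self_tail a))

theorem IsMultiderivation.exists_alternatingMap_D {f : A [⋀^Fin n]→ₗ[k] M}
    (hf : IsMultiderivation f.toMultilinearMap) :
    ∃ F : Ω[A⁄k] [⋀^Fin n]→ₗ[A] M, ∀ a, F (fun i => D k A (a i)) = f a := by
  obtain ⟨F, hF⟩ := hf.exists_multilinearMap_D
  exact ⟨{ F with map_eq_zero_of_eq' := fun _ _ _ => multilinearMap_eq_zero_of_eq_of_D f hF }, hF⟩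

end Multiderivation

theorem removeNth_succ_cons {V : Type*} {n : ℕ} (w : V) (v : Fin (n + 1) → V) (j : Fin (n + 1)) :
    j.succ.removeNth (Fin.cons w v : Fin (n + 2) → V) = Fin.cons w (j.removeNth v) := by
  funext l
  refine Fin.cases rfl (fun l => ?_) l
  simp [Fin.removeNth]

namespace NambuPoisson

open KaehlerDifferential

variable {k A : Type*} [Field k] [CommRing A] [Algebra k A] {p : ℕ} (P : NambuPoisson k A p)

theorem isMultiderivation_bracket : IsMultiderivation P.bracket.toMultilinearMap :=
  fun v i b c => by
  have move_last (x : A) : P.bracket (Function.update v i x) =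
      (-1 : ℤ) ^ (i : ℕ) • (-1 : ℤ) ^ (p + 1) • P.bracket (Fin.snoc (i.removeNth v) x) := by
    rw [alternatingMap_snoc_eq_smul_curryLeft, smul_smul (_ ^ (p + 1)), ← pow_add,
      Even.neg_one_pow ⟨_, rfl⟩, one_smul, ← Fin.insertNth_removeNth, P.bracket.map_insertNth]
    rfl
  simp only [AlternatingMap.coe_multilinearMap, move_last, P.leibniz, smul_add, smul_eq_mul,
    mul_smul_comm]

theorem curryLeft_bracket_bracket (hp : Even p) (x : Fin (p + 2) → A) (y : Fin (p + 1) → A) :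
    P.bracket.curryLeft (P.bracket x) y = ∑ l : Fin (p + 2), (-1 : ℤ) ^ (l : ℕ) •
      P.bracket.curryLeft (P.bracket.curryLeft (x l) y) (l.removeNth x) := by
  have h := P.fundamental y x
  simp only [alternatingMap_snoc_eq_smul_curryLeft, hp.add_one.neg_one_pow, neg_smul, one_smul,
    P.bracket.map_update_neg, Finset.sum_neg_distrib, neg_inj] at h
  simp only [← Fin.insertNth_removeNth, P.bracket.map_insertNth] at h
  exact h

theorem jacobiator_bracket (hp : Even p) (hk : ((p + 3 : ℕ) : k) ≠ 0) :
    jacobiator P.bracket = 0 := by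
  refine AlternatingMap.ext fun v => ?_
  have h : p + 1 + (p + 1) = 2 * p + 2 := by omega
  have swap (b : A) (u : Fin (2 * p + 2) → A) :
      shuffleSum h (fun x y => P.bracket.curryLeft (P.bracket.curryLeft b y) x) u =
        -shuffleSum h (fun x y => P.bracket.curryLeft (P.bracket.curryLeft b x) y) u := by
    refine (shuffleSum_swap_blocks h h
      (fun x y => P.bracket.curryLeft (P.bracket.curryLeft b x) y) u).trans ?_
    rw [(hp.add_one.mul hp.add_one).neg_one_pow, neg_smul, one_smul]
  -- The fundamental identity also makes `J` equal to `m` times the sum of the terms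
  -- `± {{b, y₁, …, yₘ₋₁}, x₁, …, xₘ₋₁}`, in which the two blocks of odd length are exchanged.
  have neg_self : jacobiator P.bracket v = (p + 2) • -jacobiator P.bracket v := calc
    jacobiator P.bracket v
      = shuffleSum (q := p + 1 + 1) (r := p + 1) (by omega)
          (fun x y => ∑ l : Fin (p + 2), (-1 : ℤ) ^ (l : ℕ) •
            P.bracket.curryLeft (P.bracket.curryLeft (x l) y) (l.removeNth x)) v := by
        rw [jacobiator, shuffleProduct_apply]
        simp only [P.curryLeft_bracket_bracket hp]
    _ = (p + 2) • shuffleSum (q := p + 1 + 1) (r := p + 1) (by omega)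
          (fun x y => P.bracket.curryLeft (P.bracket.curryLeft (x 0) y) (Fin.tail x)) v :=
        shuffleSum_sum_removeNth (q := p + 1) _
          (fun b x y => P.bracket.curryLeft (P.bracket.curryLeft b y) x) v
    _ = (p + 2) • ∑ i : Fin (2 * p + 2 + 1), (-1 : ℤ) ^ (i : ℕ) • shuffleSum h
          (fun x y => P.bracket.curryLeft (P.bracket.curryLeft (v i) y) x) (i.removeNth v) :=
        congrArg ((p + 2) • ·) <| shuffleSum_eq_sum_removeNth (q := p + 1) (r := p + 1) _ h
          (fun b x y => P.bracket.curryLeft (P.bracket.curryLeft b y) x) v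
    _ = (p + 2) • -jacobiator P.bracket v := by
        rw [jacobiator_apply_eq_sum_removeNth h]
        simp only [swap, smul_neg, Finset.sum_neg_distrib]
  rw [smul_neg, eq_neg_iff_add_eq_zero, ← succ_nsmul', ← Nat.cast_smul_eq_nsmul k] at neg_self
  exact (smul_eq_zero.mp neg_self).resolve_left hk

/-- The `A`-multilinear form `π` on differentials with `π (da₁, …, daₘ) = {a₁, …, aₘ}`. -/
noncomputable def poissonTensor : Ω[A⁄k] [⋀^Fin (p + 2)]→ₗ[A] A :=
  P.isMultiderivation_bracket.exists_alternatingMap_D.choose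

theorem poissonTensor_D (a : Fin (p + 2) → A) :
    P.poissonTensor (fun i => D k A (a i)) = P.bracket a :=
  P.isMultiderivation_bracket.exists_alternatingMap_D.choose_spec a

/-- The vector field `π (v₁, …, vₘ₋₁, d ·)` of `m - 1` differentials. -/
noncomputable def vectorField : Ω[A⁄k] [⋀^Fin (p + 1)]→ₗ[A] Derivation k A A :=
  (linearMapEquivDerivation k A).toLinearMap.compAlternatingMap (curryLast P.poissonTensor)

theorem liftKaehlerDifferential_vectorField (v : Fin (p + 1) → Ω[A⁄k]) :
    (P.vectorField v).liftKaehlerDifferential = curryLast P.poissonTensor v :=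
  (linearMapEquivDerivation k A).symm_apply_apply _

theorem vectorField_D (a : Fin (p + 1) → A) :
    P.vectorField (fun i => D k A (a i)) = P.hamiltonian a := by
  ext b
  change P.poissonTensor (Fin.snoc (D k A ∘ a) (D k A b)) = P.bracket (Fin.snoc a b)
  rw [← Fin.comp_snoc]
  exact P.poissonTensor_D _

/-- The anchor on Kähler differentials: the action of `vectorField` on functions. -/
noncomputable def anchor : Ω[A⁄k] [⋀^Fin (p + 1)]→ₗ[A] (A →ₗ[k] A) :=
  LinearMap.compAlternatingMap
    { toFun := fun X : Derivation k A A => (X : A →ₗ[k] A)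
      map_add' _ _ := rfl
      map_smul' _ _ := rfl } P.vectorField

theorem anchor_mul (v : Fin (p + 1) → Ω[A⁄k]) (a b : A) :
    P.anchor v (a * b) = a * P.anchor v b + b * P.anchor v a :=
  (P.vectorField v).leibniz a b

theorem anchor_D (a : Fin (p + 1) → A) :
    P.anchor (fun i => D k A (a i)) = (P.hamiltonian a : A →ₗ[k] A) :=
  congrArg Derivation.toLinearMap (P.vectorField_D a)

theorem anchor_D_apply (hp : Even p) (a : Fin (p + 1) → A) (f : A) :
    P.anchor (fun i => D k A (a i)) f = -P.bracket.curryLeft f a := by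
  rw [anchor_D]
  exact (alternatingMap_snoc_eq_smul_curryLeft P.bracket a f).trans <| by
    rw [hp.add_one.neg_one_pow, neg_smul, one_smul]

/-- The map `w ↦ ((v₁, …, vₘ₋₁) ↦ L_{X(v₁, …, vₘ₋₁)} w)`. -/
noncomputable def lieDerivativeVectorField : Ω[A⁄k] →ₗ[k] Ω[A⁄k] [⋀^Fin (p + 1)]→ₗ[k] Ω[A⁄k] where
  toFun w := (lieDerivativeBilin w).compAlternatingMap (alternatingRestrictScalars k P.vectorField)
  map_add' w w' := by rw [map_add, LinearMap.add_compAlternatingMap]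
  map_smul' c w := by rw [map_smul, LinearMap.smul_compAlternatingMap, RingHom.id_apply]

/-- The bracket of Kähler differentials,
`[v₁, …, vₘ] = ∑ᵢ (-1)^(m - i) L_{X(v₁, …, v̂ᵢ, …, vₘ)} vᵢ - (m - 1) d π(v₁, …, vₘ)`. -/
noncomputable def differentialBracket : Ω[A⁄k] [⋀^Fin (p + 2)]→ₗ[k] Ω[A⁄k] :=
  -AlternatingMap.alternatizeUncurryFin P.lieDerivativeVectorField -
    (p + 1) • (D k A).toLinearMap.compAlternatingMap (alternatingRestrictScalars k P.poissonTensor)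

theorem differentialBracket_apply (v : Fin (p + 2) → Ω[A⁄k]) :
    P.differentialBracket v =
      -∑ i : Fin (p + 2), (-1 : ℤ) ^ (i : ℕ) •
          lieDerivative (P.vectorField (i.removeNth v)) (v i) -
        (p + 1) • D k A (P.poissonTensor v) := by
  rw [differentialBracket, AlternatingMap.sub_apply, AlternatingMap.neg_apply,
    AlternatingMap.alternatizeUncurryFin_apply]
  rfl

theorem curryLast_poissonTensor_removeNth (hp : Even p) (i : Fin (p + 2))
    (v : Fin (p + 2) → Ω[A⁄k]) :
    curryLast P.poissonTensor (i.removeNth v) (v i) =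
      -((-1 : ℤ) ^ (i : ℕ) • P.poissonTensor v) := by
  rw [curryLast_removeNth, hp.add_one.neg_one_pow, neg_smul, one_smul]

theorem differentialBracket_D (hp : Even p) (a : Fin (p + 2) → A) :
    P.differentialBracket (fun i => D k A (a i)) = D k A (P.bracket a) := by
  have summand (i : Fin (p + 2)) : (-1 : ℤ) ^ (i : ℕ) •
      lieDerivative (P.vectorField (i.removeNth fun j => D k A (a j))) (D k A (a i)) =
        -D k A (P.bracket a) := by
    have h : P.vectorField (i.removeNth fun j => D k A (a j)) (a i) =
        -((-1 : ℤ) ^ (i : ℕ) • P.bracket a) := by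
      rw [← P.poissonTensor_D, ← P.curryLast_poissonTensor_removeNth hp]
      rfl
    rw [lieDerivative_D, h, map_neg, map_zsmul, smul_neg, smul_smul, ← pow_add,
      Even.neg_one_pow ⟨_, rfl⟩, one_smul]
  rw [differentialBracket_apply, poissonTensor_D]
  simp only [summand, Finset.sum_const, Finset.card_univ, Fintype.card_fin]
  module

theorem differentialBracket_curryLeft (w : Ω[A⁄k]) (v : Fin (p + 1) → Ω[A⁄k]) :
    P.differentialBracket.curryLeft w v =
      -lieDerivative (P.vectorField v) w +
          ∑ j : Fin (p + 1), (-1 : ℤ) ^ (j : ℕ) •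
            lieDerivative (P.vectorField.curryLeft w (j.removeNth v)) (v j) -
        (p + 1) • D k A (P.poissonTensor.curryLeft w v) := by
  refine (P.differentialBracket_apply (Fin.cons w v)).trans ?_
  simp only [Fin.sum_univ_succ, Fin.val_zero, Fin.val_succ, pow_zero, one_smul, pow_succ,
    mul_neg_one, neg_smul, Finset.sum_neg_distrib, Fin.cons_zero, Fin.cons_succ,
    Fin.removeNth_zero, Fin.tail_cons, removeNth_succ_cons, neg_add, neg_neg]
  rfl

theorem isAnchor (hp : Even p) : IsAnchor P.differentialBracket P.anchor := by
  refine (isAnchor_iff_curryLeft hp).mpr fun v a w => ?_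
  have summand (j : Fin (p + 1)) : (-1 : ℤ) ^ (j : ℕ) •
      lieDerivative (P.vectorField.curryLeft (a • w) (j.removeNth v)) (v j) =
        a • (-1 : ℤ) ^ (j : ℕ) •
            lieDerivative (P.vectorField.curryLeft w (j.removeNth v)) (v j) +
          P.poissonTensor.curryLeft w v • D k A a := by
    have pairing : (P.vectorField.curryLeft w (j.removeNth v)).liftKaehlerDifferential (v j) =
        (-1 : ℤ) ^ (j : ℕ) • P.poissonTensor.curryLeft w v := by
      have h := P.curryLast_poissonTensor_removeNth hp j.succ (Fin.cons w v)
      rw [removeNth_succ_cons, Fin.cons_succ, Fin.val_succ, pow_succ, mul_neg_one, neg_smul,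
        neg_neg, ← P.liftKaehlerDifferential_vectorField] at h
      exact h
    rw [map_smul, AlternatingMap.smul_apply, lieDerivative_smul_left, pairing, smul_add,
      smul_comm a, smul_assoc, smul_smul (_ ^ _), ← pow_add, Even.neg_one_pow ⟨_, rfl⟩, one_smul]
  simp only [P.differentialBracket_curryLeft _ v, summand, Finset.sum_add_distrib,
    ← Finset.smul_sum, Finset.sum_const, Finset.card_univ, Fintype.card_fin, lieDerivative_smul]
  rw [map_smul, AlternatingMap.smul_apply, smul_eq_mul, Derivation.leibniz]
  change _ = _ - P.vectorField v a • w
  module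

theorem anchorDefect_D (hp : Even p) (hk : ((p + 3 : ℕ) : k) ≠ 0) (f : A)
    (a : Fin (2 * p + 1 + 1) → A) :
    anchorDefect P.differentialBracket P.anchor f (fun i => D k A (a i)) = 0 := by
  have bracket_term (x : Fin (p + 2) → A) (y : Fin p → A) :
      (anchorAt P.anchor f).curryLeft (P.differentialBracket fun i => D k A (x i))
          (fun j => D k A (y j)) =
        (P.bracket.curryLeft (P.bracket x)).curryLeft f y := by
    rw [P.differentialBracket_D hp, alternatingMap_curryLeft_curryLeft_swap]
    refine Eq.trans (congrArg (P.anchor · f) ?_)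
      (P.anchor_D_apply hp (Fin.cons (P.bracket x) y) f)
    exact (Fin.comp_cons (D k A) (P.bracket x) y).symm
  have anchor_term (x y : Fin (p + 1) → A) :
      anchorAt P.anchor (anchorAt P.anchor f fun i => D k A (x i)) (fun j => D k A (y j)) =
        P.bracket.curryLeft (P.bracket.curryLeft f x) y := by
    simp only [anchorAt_apply, P.anchor_D_apply hp, map_neg, AlternatingMap.neg_apply, neg_neg]
  have h := congrArg (· (Fin.cons f a)) (P.jacobiator_bracket hp hk)
  simp only [jacobiator, AlternatingMap.zero_apply] at h
  rw [shuffleProduct_cons _ (by omega) (by omega), hp.add_one.add_one.neg_one_pow, one_smul,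
    add_comm] at h
  rw [anchorDefect, AlternatingMap.add_apply, AlternatingMap.smul_apply,
    AlternatingMap.smul_apply, shuffleProduct_apply, shuffleProduct_apply,
    shuffleSum_comp (D k A), shuffleSum_comp (D k A)]
  simp only [bracket_term, anchor_term]
  exact h

theorem jacobiator_D (hp : Even p) (hk : ((p + 3 : ℕ) : k) ≠ 0) (a : Fin (2 * p + 2 + 1) → A) :
    jacobiator P.differentialBracket (fun i => D k A (a i)) = 0 := by
  have double_bracket (x : Fin (p + 2) → A) (y : Fin (p + 1) → A) :
      P.differentialBracket.curryLeft (P.differentialBracket fun i => D k A (x i))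
          (fun j => D k A (y j)) = D k A (P.bracket.curryLeft (P.bracket x) y) := by
    rw [P.differentialBracket_D hp]
    exact (congrArg P.differentialBracket (Fin.comp_cons (D k A) (P.bracket x) y).symm).trans
      (P.differentialBracket_D hp (Fin.cons (P.bracket x) y))
  have h := congrArg (· a) (P.jacobiator_bracket hp hk)
  simp only [jacobiator, shuffleProduct_apply, AlternatingMap.zero_apply] at h
  rw [jacobiator, shuffleProduct_apply, shuffleSum_comp (D k A)]
  simp only [double_bracket]
  exact (shuffleSum_map (D k A) _ (fun x y => P.bracket.curryLeft (P.bracket x) y) a).trans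
    ((congrArg (D k A) h).trans (map_zero (D k A)))

/-- The Lie-Rinehart `m`-algebra of Kähler differentials of a Nambu-Poisson algebra. -/
noncomputable def lieRinehart (hp : Even p) (hk : ((p + 3).factorial : k) ≠ 0) :
    LieRinehartMAlgebra k A Ω[A⁄k] p :=
  have hk' : ((p + 3 : ℕ) : k) * ((p + 2).factorial : k) ≠ 0 := by
    rwa [← Nat.cast_mul, ← Nat.factorial_succ]
  .ofSpanRange hp (right_ne_zero_of_mul hk') (span_range_derivation k A) P.differentialBracket
    P.anchor (P.isAnchor hp) P.anchor_mul (P.anchorDefect_D hp (left_ne_zero_of_mul hk'))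
    (P.jacobiator_D hp (left_ne_zero_of_mul hk'))

end NambuPoisson

theorem corollary1p3_general {k A : Type*} [Field k] [CommRing A] [Algebra k A] (p : ℕ)
    (hm : Even (p + 2)) (hk : ((p + 3).factorial : k) ≠ 0) (P : NambuPoisson k A p) :
    ∃! L : LieRinehartMAlgebra k A Ω[A⁄k] p,
      (∀ a : Fin (p + 2) → A, L.bracket (fun i => KaehlerDifferential.D k A (a i)) =
        KaehlerDifferential.D k A (P.bracket a)) ∧
      ∀ a : Fin (p + 1) → A, L.anchor (fun i => KaehlerDifferential.D k A (a i)) =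
        (P.hamiltonian a : A →ₗ[k] A) := by
  have hp : Even p := (Nat.even_add.mp hm).mpr even_two
  refine ⟨P.lieRinehart hp hk, ⟨P.differentialBracket_D hp, P.anchor_D⟩, ?_⟩
  rintro L ⟨hbracket, hanchor⟩
  exact LieRinehartMAlgebra.ext_of_span_range (KaehlerDifferential.span_range_derivation k A)
    (fun a => (hbracket a).trans (P.differentialBracket_D hp a).symm)
    fun a => (hanchor a).trans (P.anchor_D a).symm

theorem corollary1p3 {k S : Type*} [Field k] [CharZero k] [CommRing S] [Algebra k S]
    (p : ℕ) (hm : Even (p + 2)) (P : NambuPoisson k S p) (I : Ideal S) (hI : P.IsNambuIdeal I) :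
    ∃! L : LieRinehartMAlgebra k (S ⧸ I) (Ω[(S ⧸ I)⁄k]) p,
      (∀ a : Fin (p + 2) → S ⧸ I,
        L.bracket (fun i => KaehlerDifferential.D k (S ⧸ I) (a i)) =
          KaehlerDifferential.D k (S ⧸ I) ((P.quotient I hI).bracket a)) ∧
      ∀ a : Fin (p + 1) → S ⧸ I,
        L.anchor (fun i => KaehlerDifferential.D k (S ⧸ I) (a i)) =
          ((P.quotient I hI).hamiltonian a : (S ⧸ I) →ₗ[k] (S ⧸ I)) :=
  corollary1p3_general p hm (Nat.cast_ne_zero.mpr (p + 3).factorial_ne_zero) (P.quotient I hI)
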